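/- Let $p\ge q\ge 1$ be integers. Let $M(p,q)$ be the space of real $p\times q$ matrices with Lebesgue measure $\mathrm{Leb}$, and let $P^+(q)$ be the set of real symmetric positive definite $q\times q$ matrices, with the measure $\mu(\mathrm dS)=(\det S)^{-(q+1)/2}\prod_{i\le j}\mathrm dS_{ij}$. Let $\Gamma_q(a)=\pi^{q(q-1)/4}\prod_{j=1}^{q}\Gamma(a-\tfrac{j-1}{2})$. Fix $\mathcal U,U\in P^+(p)$, $V\in P^+(q)$ and $\rho\in[0,1)$. For $M\in M(p,q)$, $\Sigma\in P^+(p)$, $T\in P^+(q)$, let $N_{p,q}(M,\Sigma,T)$ be the law on $M(p,q)$ with Lebesgue density $$\frac{\exp\big(-\tfrac12\operatorname{tr}[T^{-1}(X-M)^\top\Sigma^{-1}(X-M)]\big)}{(2\pi)^{pq/2}(\det\Sigma)^{q/2}(\det T)^{p/2}} .$$ *Upcasting.* Put $$\nu_{\mathcal U}(\mathrm dx)=\frac{\Gamma_q(p/2)}{\pi^{pq/2}}\,\frac{(\det\mathcal U)^{-q/2}}{\det(x^\top\mathcal U^{-1}x)^{p/2}}\,\mathrm{Leb}(\mathrm dx).$$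 The upcast target of $\tilde\Pi(\mathrm dS)=\tilde\pi(S)\mu(\mathrm dS)$ on $P^+(q)$ is $\Pi(\mathrm dx)=\tilde\pi(x^\top\mathcal U^{-1}x)\,\nu_{\mathcal U}(\mathrm dx)$ on $M(p,q)$, where the integrand is set to $0$ on the null set of those $x$ without full column rank. *pCN kernel.* Let $Q(x,\cdot)$ be the law of $\rho^{1/2}x+(1-\rho)^{1/2}w$ with $w\sim N_{p,q}(0,U,V)$, and let $f=\mathrm d\Pi/\mathrm dN_{p,q}(0,U,V)$ be the density given by the quotient of the explicit Lebesgue densities above. Let $\alpha(x,y)=\min\{1,f(y)/f(x)\}$, read as $1$ if $f(x)=0$. The pCN kernel with target $\Pi$ is $$P(x,A)=\int_A\alpha(x,y)\,Q(x,\mathrm dy)+\Big(1-\int\alpha(x,y)\,Q(x,\mathrm dy)\Big)\delta_x(A).$$ *Geometric ergodicity.* A Markov kernel $P$ is geometrically ergodic if there are a probability measure $\nu$ and $r\in(0,1)$ such that $x\mapsto\sup_{n\ge0}r^{-n}\|P^n(x,\cdot)-\nu\|_{\mathrm{TV}}$ is $\nu$-integrable, where $\|\nu_1-\nu_2\|_{\mathrm{TV}}=\sup_A|\nu_1(A)-\nu_2(A)|$.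 *Regular variation.* For $A,B\in P^+(q)$ let $\mathsf d(A,B)=\big(\sum_{i=1}^q\log^2\lambda_i\big)^{1/2}$, where $\lambda_1,\dots,\lambda_q$ are the eigenvalues of $B^{-1/2}AB^{-1/2}$. A function $h:P^+(q)\to(0,\infty)$ is regularly varying if for some real $r>q-1$ one has $h(zx)/h(zI_q)\to\det(x)^{-r/2}$ as $z\to+\infty$, locally uniformly in $x\in P^+(q)$ for $\mathsf d$. **Claim.** (i) Let $\tilde\Pi(\mathrm dS)=\tilde\pi(S)\mu(\mathrm dS)$ be a probability measure on $P^+(q)$. If $\tilde\pi$ is continuous and regularly varying, then the pCN kernel on $M(p,q)$ whose target is the corresponding upcast law is not geometrically ergodic. (ii) In particular, for every real $r>q-1$ and every $T\in P^+(q)$, the pCN kernel whose target is the upcast law of the Inverse-Wishart distribution $W_q^{-1}(r,T)$, which has $\mu$-density $$\tilde\pi(S)=\frac{(\det T)^{r/2}\exp(-\tfrac12\operatorname{tr}[TS^{-1}])}{2^{rq/2}(\det S)^{r/2}\Gamma_q(r/2)},$$ is not geometrically ergodic. -/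

import Mathlib

open MeasureTheory ProbabilityTheory
open scoped ENNReal Matrix

noncomputable section

namespace MatrixMCMC

/-! ### Matrix spaces -/

/-- Lebesgue measure `∏ dX_ij` on the space of `m × n` real matrices, with its product
(equivalently Borel) sigma-algebra. -/
instance instMeasureSpaceMatrix {m n : Type*} [Fintype m] [Fintype n] :
    MeasureSpace (Matrix m n ℝ) :=
  inferInstanceAs (MeasureSpace (m → n → ℝ))

instance instBorelSpaceMatrix {m n : Type*} [Fintype m] [Fintype n] :
    BorelSpace (Matrix m n ℝ) :=
  inferInstanceAs (BorelSpace (m → n → ℝ))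

instance instSigmaFiniteMatrix {m n : Type*} [Fintype m] [Fintype n] :
    SigmaFinite (volume : Measure (Matrix m n ℝ)) :=
  inferInstanceAs (SigmaFinite (volume : Measure (m → n → ℝ)))

instance instSecondCountableMatrix {m n : Type*} [Fintype m] [Fintype n] :
    SecondCountableTopology (Matrix m n ℝ) :=
  inferInstanceAs (SecondCountableTopology (m → n → ℝ))

/-- `M(p,q)`: real `p × q` matrices. -/
abbrev Mat (p q : ℕ) : Type := Matrix (Fin p) (Fin q) ℝ

/-- `P⁺(q)`: symmetric positive definite real `q × q` matrices. -/
abbrev PDMat (q : ℕ) : Type := {S : Mat q q // S.PosDef}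

namespace PDMat

/-- The identity matrix as an element of `P⁺(q)`. -/
def one (q : ℕ) : PDMat q := ⟨1, Matrix.PosDef.one⟩

/-- The scalar multiple `z S` of `S ∈ P⁺(q)`, for `z > 0`. -/
def scale {q : ℕ} (z : ℝ) (hz : 0 < z) (S : PDMat q) : PDMat q := ⟨z • S.1, S.2.smul hz⟩

/-- The inverse in `P⁺(q)`. -/
def inv {q : ℕ} (S : PDMat q) : PDMat q := ⟨S.1⁻¹, S.2.inv⟩

open scoped MatrixOrder in
/-- The positive definite square root `S^{1/2}`. -/
def sqrt {q : ℕ} (S : PDMat q) : PDMat q :=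
  ⟨CFC.sqrt S.1, by
    have h0 : (CFC.sqrt S.1).PosSemidef :=
      Matrix.nonneg_iff_posSemidef.mp (CFC.sqrt_nonneg S.1)
    refine h0.posDef_iff_det_ne_zero.mpr fun h => ?_
    have h1 : CFC.sqrt S.1 * CFC.sqrt S.1 = S.1 :=
      CFC.sqrt_mul_sqrt_self S.1 S.2.posSemidef.nonneg
    have h2 := congrArg Matrix.det h1
    rw [Matrix.det_mul, h, mul_zero] at h2
    exact S.2.det_pos.ne h2⟩

/-- `A ∘ B = B^{1/2} A B^{1/2}`. -/
def circ {q : ℕ} (A B : PDMat q) : PDMat q :=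
  ⟨(sqrt B).1 * A.1 * (sqrt B).1, by
    have h := A.2.conjTranspose_mul_mul_same
      (B := (sqrt B).1) (Matrix.mulVec_injective_of_isUnit (sqrt B).2.isUnit)
    rwa [(sqrt B).2.isHermitian.eq] at h⟩

/-- The metric `d(A,B) = (∑ᵢ log² λᵢ)^{1/2}`, with `λᵢ` the eigenvalues of `A ∘ B⁻¹`. -/
def logDist {q : ℕ} (A B : PDMat q) : ℝ :=
  Real.sqrt (∑ i, Real.log ((circ A (inv B)).2.isHermitian.eigenvalues i) ^ 2)

end PDMat

/-! ### Reference measures and densities -/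

/-- The multivariate Gamma function
`Γ_q(a) = π^{q(q-1)/4} ∏_{j=1}^q Γ(a - (j-1)/2)`. -/
def multivariateGamma (q : ℕ) (a : ℝ) : ℝ :=
  Real.pi ^ ((q : ℝ) * ((q : ℝ) - 1) / 4) * ∏ j : Fin q, Real.Gamma (a - (j : ℝ) / 2)

/-- The Lebesgue density of the measure `ν_𝒰` on `M(p,q)`. -/
def nuDensity {p q : ℕ} (𝒰 : PDMat p) (x : Mat p q) : ℝ :=
  multivariateGamma q ((p : ℝ) / 2) / Real.pi ^ ((p : ℝ) * q / 2) *
    (𝒰.1.det ^ (-(q : ℝ) / 2) / (xᵀ * 𝒰.1⁻¹ * x).det ^ ((p : ℝ) / 2))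

/-- The measure `ν_𝒰` on `M(p,q)`. -/
def nu (q : ℕ) {p : ℕ} (𝒰 : PDMat p) : Measure (Mat p q) :=
  volume.withDensity fun x => ENNReal.ofReal (nuDensity 𝒰 x)

/-- The symmetric matrix with prescribed entries on and above the diagonal. -/
def symOfUpper (q : ℕ) (u : {ij : Fin q × Fin q // ij.1 ≤ ij.2} → ℝ) : Mat q q :=
  Matrix.of fun i j => u ⟨(min i j, max i j), min_le_max⟩

/-- The measure `∏_{i ≤ j} dS_ij` on `P⁺(q)`. -/
def lebPD (q : ℕ) : Measure (PDMat q) :=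
  ((volume : Measure ({ij : Fin q × Fin q // ij.1 ≤ ij.2} → ℝ)).map (symOfUpper q)).comap
    Subtype.val

/-- The measure `μ(dS) = det(S)^{-(q+1)/2} ∏_{i ≤ j} dS_ij` on `P⁺(q)`. -/
def muPD (q : ℕ) : Measure (PDMat q) :=
  (lebPD q).withDensity fun S => ENNReal.ofReal (S.1.det ^ (-((q : ℝ) + 1) / 2))

/-- The Lebesgue density of the Matrix-Normal distribution `N_{p,q}(M, Σ, T)`. -/
def matrixNormalPDF {p q : ℕ} (M : Mat p q) (Sig : PDMat p) (T : PDMat q) (x : Mat p q) : ℝ :=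
  Real.exp (-(T.1⁻¹ * (x - M)ᵀ * Sig.1⁻¹ * (x - M)).trace / 2) /
    ((2 * Real.pi) ^ ((p : ℝ) * q / 2) * Sig.1.det ^ ((q : ℝ) / 2) * T.1.det ^ ((p : ℝ) / 2))

/-- The Matrix-Normal distribution `N_{p,q}(M, Σ, T)`. -/
def matrixNormal {p q : ℕ} (M : Mat p q) (Sig : PDMat p) (T : PDMat q) : Measure (Mat p q) :=
  volume.withDensity fun x => ENNReal.ofReal (matrixNormalPDF M Sig T x)

/-- The density of the Inverse-Wishart distribution `W_q⁻¹(r, T)` with respect to `muPD q`. -/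
def invWishartDensity {q : ℕ} (r : ℝ) (T : PDMat q) (S : PDMat q) : ℝ :=
  T.1.det ^ (r / 2) * Real.exp (-(T.1 * S.1⁻¹).trace / 2) /
    ((2 : ℝ) ^ (r * q / 2) * S.1.det ^ (r / 2) * multivariateGamma q (r / 2))

/-- `h : P⁺(q) → (0,∞)` is regularly varying: for some `r > q - 1`,
`h(z x) / h(z I) → det(x)^{-r/2}` as `z → ∞`, locally uniformly in `x` for the metric `logDist`. -/
def IsRegularlyVarying {q : ℕ} (h : PDMat q → ℝ) : Prop :=
  (∀ S, 0 < h S) ∧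
  ∃ r : ℝ, (q : ℝ) - 1 < r ∧
    ∀ x₀ : PDMat q, ∃ ε : ℝ, 0 < ε ∧
      ∀ δ : ℝ, 0 < δ → ∃ z₀ : ℝ, ∀ (z : ℝ) (hz : 0 < z), z₀ ≤ z →
        ∀ x : PDMat q, PDMat.logDist x x₀ < ε →
          |h (x.scale z hz) / h ((PDMat.one q).scale z hz) - x.1.det ^ (-r / 2)| < δ

/-! ### Upcasting -/

/-- The function `x ↦ π̃(xᵀ 𝒰⁻¹ x)` on `M(p,q)`; it takes the value `0` on the Lebesgue-null set
of those `x` that do not have full column rank, where `xᵀ 𝒰⁻¹ x` is not in `P⁺(q)`. -/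
def upcastFun {p q : ℕ} (𝒰 : PDMat p) (dens : PDMat q → ℝ) (x : Mat p q) : ℝ≥0∞ :=
  open Classical in
  if h : (xᵀ * 𝒰.1⁻¹ * x).PosDef then ENNReal.ofReal (dens ⟨_, h⟩) else 0

/-- The upcast law `Π(dx) = π̃(xᵀ 𝒰⁻¹ x) ν_𝒰(dx)` on `M(p,q)`. -/
def upcastLaw {p q : ℕ} (𝒰 : PDMat p) (dens : PDMat q → ℝ) : Measure (Mat p q) :=
  (nu q 𝒰).withDensity (upcastFun 𝒰 dens)

/-- The density of the upcast law with respect to `N_{p,q}(0, U, V)`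
(see `matrixNormal_withDensity_upcastRatio`). -/
def upcastRatio {p q : ℕ} (𝒰 U : PDMat p) (V : PDMat q) (dens : PDMat q → ℝ) (x : Mat p q) :
    ℝ≥0∞ :=
  upcastFun 𝒰 dens x * ENNReal.ofReal (nuDensity 𝒰 x) / ENNReal.ofReal (matrixNormalPDF 0 U V x)

theorem isClosed_posSemidef (q : ℕ) : IsClosed {S : Mat q q | S.PosSemidef} := by
  have h : {S : Mat q q | S.PosSemidef} =
      {S : Mat q q | Sᴴ = S} ∩ ⋂ v : Fin q → ℝ, {S : Mat q q | 0 ≤ star v ⬝ᵥ (S *ᵥ v)} := by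
    ext S
    simp only [Set.mem_ofPred_eq, Set.mem_inter_iff, Set.mem_iInter]
    exact Matrix.posSemidef_iff_dotProduct_mulVec
  rw [h]
  refine IsClosed.inter (isClosed_eq (by fun_prop) (by fun_prop)) (isClosed_iInter fun v => ?_)
  exact isClosed_le continuous_const (by fun_prop)

theorem measurableSet_posDef (q : ℕ) : MeasurableSet {S : Mat q q | S.PosDef} := by
  have h : {S : Mat q q | S.PosDef} = {S | S.PosSemidef} ∩ {S | S.det ≠ 0} := by
    ext S
    exact ⟨fun hS => ⟨hS.posSemidef, hS.det_pos.ne'⟩,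
      fun hS => hS.1.posDef_iff_det_ne_zero.mpr hS.2⟩
  rw [h]
  refine (isClosed_posSemidef q).measurableSet.inter (IsOpen.measurableSet ?_)
  exact isOpen_ne_fun (by fun_prop) (by fun_prop)

/-- `lebPD q` is Lebesgue measure in the coordinates `(S_ij)_{i ≤ j}`. -/
theorem lebPD_apply (q : ℕ) {s : Set (PDMat q)} (hs : MeasurableSet s) :
    lebPD q s = volume {u | ∃ S ∈ s, symOfUpper q u = S.1} := by
  have hm : Measurable (symOfUpper q) := by
    refine measurable_pi_lambda _ fun i => measurable_pi_lambda _ fun j => ?_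
    exact measurable_pi_apply _
  have he : MeasurableEmbedding (Subtype.val : PDMat q → Mat q q) :=
    MeasurableEmbedding.subtype_coe (measurableSet_posDef q)
  rw [lebPD, he.comap_apply, Measure.map_apply hm (he.measurableSet_image.mpr hs)]
  congr 1
  ext u
  simp [eq_comm]

theorem measurable_upcastFun {p q : ℕ} (𝒰 : PDMat p) {dens : PDMat q → ℝ}
    (hd : Measurable dens) : Measurable (upcastFun 𝒰 dens) := by
  classical
  have hg : Measurable fun x : Mat p q => xᵀ * 𝒰.1⁻¹ * x :=
    Continuous.measurable (by fun_prop)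
  have hs : MeasurableSet {x : Mat p q | (xᵀ * 𝒰.1⁻¹ * x).PosDef} := hg (measurableSet_posDef q)
  refine Measurable.dite (f := fun x : {x : Mat p q | (xᵀ * 𝒰.1⁻¹ * x).PosDef} =>
    ENNReal.ofReal (dens ⟨_, x.2⟩)) (g := fun _ => 0) ?_ measurable_const hs
  exact ENNReal.measurable_ofReal.comp
    (hd.comp ((hg.comp measurable_subtype_coe).subtype_mk))

theorem measurable_nuDensity {p q : ℕ} (𝒰 : PDMat p) :
    Measurable (nuDensity 𝒰 : Mat p q → ℝ) := by
  have hg : Measurable fun x : Mat p q => (xᵀ * 𝒰.1⁻¹ * x).det :=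
    Continuous.measurable (by fun_prop)
  unfold nuDensity
  exact ((hg.pow_const _).const_div _).const_mul _

theorem measurable_matrixNormalPDF {p q : ℕ} (M : Mat p q) (Sig : PDMat p) (T : PDMat q) :
    Measurable (matrixNormalPDF M Sig T) := by
  unfold matrixNormalPDF
  exact Continuous.measurable (Continuous.div_const (by fun_prop) _)

theorem matrixNormalPDF_pos {p q : ℕ} (M : Mat p q) (Sig : PDMat p) (T : PDMat q) (x : Mat p q) :
    0 < matrixNormalPDF M Sig T x := by
  have h1 := Sig.2.det_pos
  have h2 := T.2.det_pos
  have h3 := Real.pi_pos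
  unfold matrixNormalPDF
  positivity

theorem measurable_upcastRatio {p q : ℕ} (𝒰 U : PDMat p) (V : PDMat q) {dens : PDMat q → ℝ}
    (hd : Measurable dens) : Measurable (upcastRatio 𝒰 U V dens) :=
  ((measurable_upcastFun 𝒰 hd).mul (measurable_nuDensity 𝒰).ennreal_ofReal).div
    (measurable_matrixNormalPDF 0 U V).ennreal_ofReal

/-- `upcastRatio` is indeed a density of the upcast law with respect to `N_{p,q}(0, U, V)`. -/
theorem matrixNormal_withDensity_upcastRatio {p q : ℕ} (𝒰 U : PDMat p) (V : PDMat q)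
    {dens : PDMat q → ℝ} (hd : Measurable dens) :
    (matrixNormal 0 U V).withDensity (upcastRatio 𝒰 U V dens) = upcastLaw 𝒰 dens := by
  have h1 := (measurable_matrixNormalPDF (0 : Mat p q) U V).ennreal_ofReal
  have h2 := (measurable_nuDensity (q := q) 𝒰).ennreal_ofReal
  unfold matrixNormal upcastLaw nu
  rw [← withDensity_mul _ h1 (measurable_upcastRatio 𝒰 U V hd),
    ← withDensity_mul _ h2 (measurable_upcastFun 𝒰 hd)]
  congr 1
  ext x
  have hpos : ENNReal.ofReal (matrixNormalPDF 0 U V x) ≠ 0 :=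
    (ENNReal.ofReal_pos.mpr (matrixNormalPDF_pos 0 U V x)).ne'
  simp only [Pi.mul_apply, upcastRatio]
  rw [ENNReal.mul_div_cancel hpos ENNReal.ofReal_ne_top, mul_comm]

/-! ### Metropolis-Hastings kernels -/

section Metropolis

variable {E : Type*} [MeasurableSpace E]

/-- The acceptance probability `α(x,y) = min{1, f(y)/f(x)}`, read as `1` when `f(x) = 0`. -/
def acceptProb (f : E → ℝ≥0∞) (x y : E) : ℝ≥0∞ :=
  open Classical in if f x = 0 then 1 else min 1 (f y / f x)

theorem measurable_acceptProb {f : E → ℝ≥0∞} (hf : Measurable f) :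
    Measurable (Function.uncurry (acceptProb f)) := by
  classical
  unfold acceptProb Function.uncurry
  refine Measurable.ite ((hf.comp measurable_fst) (measurableSet_singleton 0)) measurable_const ?_
  exact measurable_const.min ((hf.comp measurable_snd).div (hf.comp measurable_fst))

/-- The Metropolis-Hastings kernel
`P(x,A) = ∫_A α(x,y) Q(x,dy) + R(x) δ_x(A)`, `R(x) = 1 - ∫ α(x,y) Q(x,dy)`,
for a proposal `Q` and a density `f` of the target with respect to a measure for which `Q` is
reversible. -/
def metropolisKernel (Q : Kernel E E) [IsSFiniteKernel Q] (f : E → ℝ≥0∞) (hf : Measurable f) :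
    Kernel E E where
  toFun x := (Q x).withDensity (acceptProb f x) +
    (1 - ∫⁻ y, acceptProb f x y ∂(Q x)) • Measure.dirac x
  measurable' := by
    have ha := measurable_acceptProb hf
    have hR : Measurable fun x => 1 - ∫⁻ y, acceptProb f x y ∂(Q x) :=
      measurable_const.sub ha.lintegral_kernel_prod_right'
    refine Measure.measurable_of_measurable_coe _ fun s hs => ?_
    simp only [Measure.add_apply, Measure.smul_apply, smul_eq_mul, withDensity_apply _ hs]
    refine Measurable.add ?_ (hR.mul ((Measure.measurable_coe hs).comp Measure.measurable_dirac))
    exact Measurable.setLIntegral_kernel_prod_right ha hs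

/-- Total variation distance `sup_A |μ(A) - ν(A)|`. -/
def tvDist (μ ν : Measure E) : ℝ≥0∞ :=
  ⨆ (A : Set E) (_ : MeasurableSet A), ENNReal.ofReal |μ.real A - ν.real A|

/-- A Markov kernel `P` is geometrically ergodic if there are a probability measure `ν` and
`r ∈ (0,1)` with `x ↦ sup_n r⁻ⁿ ‖Pⁿ(x,·) - ν‖_TV` integrable with respect to `ν`. -/
def IsGeometricallyErgodic (P : Kernel E E) : Prop :=
  ∃ ν : Measure E, IsProbabilityMeasure ν ∧ ∃ r : ℝ, 0 < r ∧ r < 1 ∧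
    ∫⁻ x, ⨆ n : ℕ, ENNReal.ofReal ((r ^ n)⁻¹) * tvDist ((P ^ n) x) ν ∂ν < ∞

end Metropolis

/-! ### The pCN kernel -/

instance {p q : ℕ} (M : Mat p q) (Sig : PDMat p) (T : PDMat q) :
    SFinite (matrixNormal M Sig T) :=
  inferInstanceAs (SFinite (volume.withDensity _))

/-- The pCN proposal: `Q(x,·)` is the law of `ρ^{1/2} x + (1-ρ)^{1/2} w`,
`w ∼ N_{p,q}(0, U, V)`. -/
def pcnProposal {p q : ℕ} (U : PDMat p) (V : PDMat q) (ρ : ℝ) : Kernel (Mat p q) (Mat p q) :=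
  (Kernel.id ×ₖ Kernel.const (Mat p q) (matrixNormal 0 U V)).map
    fun z => Real.sqrt ρ • z.1 + Real.sqrt (1 - ρ) • z.2

instance {p q : ℕ} (U : PDMat p) (V : PDMat q) (ρ : ℝ) : IsSFiniteKernel (pcnProposal U V ρ) :=
  inferInstanceAs (IsSFiniteKernel (Kernel.map _ _))

theorem pcnProposal_apply {p q : ℕ} (U : PDMat p) (V : PDMat q) (ρ : ℝ) (x : Mat p q) :
    pcnProposal U V ρ x =
      (matrixNormal 0 U V).map fun w => Real.sqrt ρ • x + Real.sqrt (1 - ρ) • w := by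
  have h : Measurable fun z : Mat p q × Mat p q =>
      Real.sqrt ρ • z.1 + Real.sqrt (1 - ρ) • z.2 := Continuous.measurable (by fun_prop)
  unfold pcnProposal
  rw [Kernel.map_apply _ h, Kernel.prod_apply, Kernel.id_apply, Kernel.const_apply,
    Measure.dirac_prod, Measure.map_map h measurable_prodMk_left]
  rfl

/-- The pCN kernel on `M(p,q)` with parameters `U`, `V`, `ρ`, whose target is the upcast law
`π̃(xᵀ 𝒰⁻¹ x) ν_𝒰(dx)`. -/
def pcnKernel {p q : ℕ} (𝒰 U : PDMat p) (V : PDMat q) (ρ : ℝ) (dens : PDMat q → ℝ)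
    (hd : Measurable dens) : Kernel (Mat p q) (Mat p q) :=
  metropolisKernel (pcnProposal U V ρ) (upcastRatio 𝒰 U V dens) (measurable_upcastRatio 𝒰 U V hd)

theorem measurable_invWishartDensity {q : ℕ} (r : ℝ) (T : PDMat q) :
    Measurable (invWishartDensity r T) := by
  have h1 : Measurable fun S : PDMat q => S.1.det := Continuous.measurable (by fun_prop)
  have h2 : Measurable fun S : PDMat q => (T.1 * S.1⁻¹).trace := by
    have h3 : Measurable fun S : PDMat q => (T.1 * S.1.adjugate).trace :=
      Continuous.measurable (by fun_prop)
    have h4 : (fun S : PDMat q => (T.1 * S.1⁻¹).trace) =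
        fun S => (S.1.det)⁻¹ * (T.1 * S.1.adjugate).trace := by
      ext S
      simp [Matrix.inv_def, Matrix.trace_smul]
    rw [h4]
    exact h1.inv.mul h3
  unfold invWishartDensity
  exact ((Real.measurable_exp.comp (h2.neg.div_const 2)).const_mul _).div
    (((h1.pow_const _).const_mul _).mul_const _)

end MatrixMCMC

end

open MatrixMCMC

namespace MatrixMCMC

open Filter Topology

/-! ### Holding probabilities of geometrically ergodic kernels -/

section HoldingProbability

variable {E : Type*} [MeasurableSpace E]

/-! Relative to the Gaussian reference, the target density along a ray `√s • x` is a factor common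
to all directions, times a factor converging to a positive limit, times `exp (s * gaussForm U V x /
2)`. The proposal contracts `x` to about `√ρ • x`, which multiplies the quadratic form by `ρ < 1`.
The density ratio therefore decays exponentially in `s`, and almost every proposal from far out is
rejected (`tendsto_acceptProb`, `tendsto_acceptance`).

Geometric ergodicity forbids such sticky regions. Staying put `n` times gives `R x ^ n ≤ (P ^ n) x
{x}`. The limit law has no atoms, because the part of `P` that moves is absolutely continuous. So a
total variation bound `C * r ^ n` with `C < ∞` forces `R x ≤ r`. Integrability gives such a finite
`C` at some point of every measurable set of positive limit mass, and every nonempty open set of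
full-rank matrices has positive limit mass (`IsGeometricallyErgodic.exists_holding_le`).

Both claims use the target only through positivity, measurability and `HasScalingLimit`. The latter
follows from regular variation once Euclidean neighbourhoods are compared with `logDist`-balls, and
is checked directly for the Inverse-Wishart density. -/

theorem isFiniteMeasure_kernel_pow (P : Kernel E E) [IsFiniteKernel P] (n : ℕ) (x : E) :
    IsFiniteMeasure ((P ^ n) x) := by
  have h : IsFiniteKernel (P ^ n) := by
    induction n with
    | zero => rw [pow_zero]; exact inferInstanceAs (IsFiniteKernel Kernel.id)
    | succ n ih => rw [Kernel.pow_add, pow_one]; infer_instance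
  infer_instance

theorem ofReal_abs_sub_le_tvDist (μ ν : Measure E) {A : Set E} (hA : MeasurableSet A) :
    ENNReal.ofReal |μ.real A - ν.real A| ≤ tvDist μ ν :=
  le_iSup₂_of_le A hA le_rfl

/-- If the integral of `g` is finite, then `g` is finite somewhere on every measurable set of
positive measure; no measurability of `g` is needed. -/
theorem exists_mem_lt_top_of_lintegral_lt_top {ν : Measure E} {g : E → ℝ≥0∞}
    (hg : ∫⁻ x, g x ∂ν < ∞) {O : Set E} (hO : MeasurableSet O) (hpos : 0 < ν O) :
    ∃ x ∈ O, g x < ∞ := by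
  by_contra! h
  have h1 : ∫⁻ x, O.indicator (fun _ => ∞) x ∂ν ≤ ∫⁻ x, g x ∂ν := by
    refine lintegral_mono fun x => ?_
    by_cases hx : x ∈ O
    · simpa [hx] using h x hx
    · simp [hx]
  rw [lintegral_indicator_const hO, ENNReal.top_mul hpos.ne'] at h1
  exact absurd (h1.trans_lt hg) (lt_irrefl _)

theorem tendsto_measure_of_tvDist_bound {μ : ℕ → Measure E} [∀ n, IsFiniteMeasure (μ n)]
    {ν : Measure E} [IsFiniteMeasure ν] {r : ℝ} (hr₀ : 0 < r) (hr₁ : r < 1)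
    (h : ⨆ n : ℕ, ENNReal.ofReal ((r ^ n)⁻¹) * tvDist (μ n) ν < ∞)
    {A : Set E} (hA : MeasurableSet A) :
    Tendsto (fun n => μ n A) atTop (𝓝 (ν A)) := by
  set C := ⨆ n : ℕ, ENNReal.ofReal ((r ^ n)⁻¹) * tvDist (μ n) ν with hC
  have hle : ∀ n, |(μ n).real A - ν.real A| ≤ C.toReal * r ^ n := by
    intro n
    have h1 : ENNReal.ofReal ((r ^ n)⁻¹) * ENNReal.ofReal |(μ n).real A - ν.real A| ≤ C :=
      (mul_le_mul_right (ofReal_abs_sub_le_tvDist (μ n) ν hA) _).trans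
        (le_iSup (fun n : ℕ => ENNReal.ofReal ((r ^ n)⁻¹) * tvDist (μ n) ν) n)
    rw [← ENNReal.ofReal_mul (by positivity), ENNReal.ofReal_le_iff_le_toReal h.ne] at h1
    have h2 : 0 < r ^ n := by positivity
    rw [inv_mul_le_iff₀ h2] at h1
    linarith
  have h0 : Tendsto (fun n => C.toReal * r ^ n) atTop (𝓝 0) := by
    simpa using (tendsto_pow_atTop_nhds_zero_of_lt_one hr₀.le hr₁).const_mul C.toReal
  have h1 : Tendsto (fun n => (μ n).real A) atTop (𝓝 (ν.real A)) := by
    rw [tendsto_iff_dist_tendsto_zero]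
    exact squeeze_zero (fun _ => dist_nonneg) hle h0
  have h2 := ENNReal.tendsto_ofReal h1
  simpa [measureReal_def, ENNReal.ofReal_toReal] using h2

variable {P : Kernel E E} {κ : E → Measure E} {R : E → ℝ≥0∞} {lam : Measure E}

/-- A chain that has moved sits, almost surely, outside a given null set. It can be in `N` at time
`n` only by starting there and never moving, hence the induction on the first step. -/
theorem pow_apply_null_le (hP : ∀ x, P x = κ x + R x • Measure.dirac x)
    (hκ : ∀ x, κ x ≪ lam) {N : Set E} (hN : MeasurableSet N) (h0 : lam N = 0) (n : ℕ) (x : E) :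
    (P ^ n) x N ≤ R x ^ n * N.indicator 1 x := by
  induction n generalizing x with
  | zero =>
    rw [show P ^ 0 = Kernel.id from pow_zero P]
    simp [Kernel.id_apply, Measure.dirac_apply' _ hN]
  | succ n ih =>
    rw [add_comm, Kernel.pow_add_apply_eq_lintegral _ _ _ _ hN, pow_one, hP x, lintegral_add_measure,
      lintegral_smul_measure, lintegral_dirac' _ (Kernel.measurable_coe _ hN)]
    have h1 : ∫⁻ b, (P ^ n) b N ∂(κ x) = 0 := by
      have : ∀ᵐ b ∂(κ x), (P ^ n) b N = 0 := by
        have hb : ∀ᵐ b ∂(κ x), b ∉ N := by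
          rw [ae_iff]; simpa using hκ x h0
        filter_upwards [hb] with b hb
        simpa [hb] using ih b
      rw [lintegral_congr_ae this]; simp
    rw [h1, zero_add, smul_eq_mul, pow_add, pow_one, mul_assoc]
    exact mul_le_mul_right (ih x) _

theorem pow_le_pow_apply_singleton [MeasurableSingletonClass E]
    (hP : ∀ x, P x = κ x + R x • Measure.dirac x) (n : ℕ) (x : E) :
    R x ^ n ≤ (P ^ n) x {x} := by
  induction n with
  | zero =>
    rw [show P ^ 0 = Kernel.id from pow_zero P]
    simp [Kernel.id_apply]
  | succ n ih =>
    rw [add_comm, Kernel.pow_add_apply_eq_lintegral _ _ _ _ (measurableSet_singleton x),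
      pow_one, hP x, lintegral_add_measure, lintegral_smul_measure,
      lintegral_dirac' _ (Kernel.measurable_coe _ (measurableSet_singleton x)), pow_add,
      pow_one, smul_eq_mul]
    exact (mul_le_mul_right ih _).trans le_add_self

/-- Invariance of `ν` is not needed. The sets where `P y O` exceeds `1 / (n + 1)` exhaust the space,
so one of them has positive `ν`-mass. One further step sends a fixed fraction of that mass into `O`,
and this survives the limit. -/
theorem measure_pos_of_tendsto_pow [IsFiniteKernel P] {ν : Measure E} [IsProbabilityMeasure ν]
    {x : E} (hx : ∀ A : Set E, MeasurableSet A → Tendsto (fun n => (P ^ n) x A) atTop (𝓝 (ν A)))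
    {O : Set E} (hO : MeasurableSet O) (hPO : ∀ y, 0 < P y O) : 0 < ν O := by
  obtain ⟨n, hn⟩ : ∃ n : ℕ, 0 < ν {y | ((n : ℝ≥0∞) + 1)⁻¹ < P y O} := by
    by_contra! h
    have hU : (⋃ n : ℕ, {y | ((n : ℝ≥0∞) + 1)⁻¹ < P y O}) = Set.univ := by
      refine Set.eq_univ_of_forall fun y => Set.mem_iUnion.mpr ?_
      obtain ⟨n, hn⟩ := ENNReal.exists_inv_nat_lt (hPO y).ne'
      exact ⟨n, lt_of_le_of_lt (ENNReal.inv_le_inv.mpr le_self_add) hn⟩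
    have : ν Set.univ = 0 := by
      rw [← hU]
      exact measure_iUnion_null fun n => le_antisymm (h n) (zero_le)
    simp at this
  set G := {y | ((n : ℝ≥0∞) + 1)⁻¹ < P y O}
  have hG : MeasurableSet G := measurableSet_lt measurable_const (Kernel.measurable_coe P hO)
  have h1 : ∀ m, ((n : ℝ≥0∞) + 1)⁻¹ * (P ^ m) x G ≤ (P ^ (m + 1)) x O := by
    intro m
    rw [Kernel.pow_succ_apply_eq_lintegral _ _ _ hO]
    calc ((n : ℝ≥0∞) + 1)⁻¹ * (P ^ m) x G
        = ∫⁻ b, G.indicator (fun _ => ((n : ℝ≥0∞) + 1)⁻¹) b ∂(P ^ m) x := by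
          rw [lintegral_indicator_const hG]
      _ ≤ ∫⁻ b, P b O ∂(P ^ m) x := by
          refine lintegral_mono fun b => ?_
          by_cases hb : b ∈ G
          · simpa [hb] using le_of_lt hb
          · simp [hb]
  have hne : ((n : ℝ≥0∞) + 1)⁻¹ ≠ ∞ := by simp
  have h2 : ((n : ℝ≥0∞) + 1)⁻¹ * ν G ≤ ν O :=
    le_of_tendsto_of_tendsto (ENNReal.Tendsto.const_mul (hx G hG) (Or.inr hne))
      ((hx O hO).comp (tendsto_add_atTop_nat 1)) (Eventually.of_forall h1)
  refine lt_of_lt_of_le (ENNReal.mul_pos ?_ hn.ne') h2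
  simp

/-- A geometrically ergodic kernel whose atom-free part is absolutely continuous cannot have
holding probabilities close to one on sets that are charged from everywhere. -/
theorem IsGeometricallyErgodic.exists_holding_le [MeasurableSingletonClass E] [IsFiniteKernel P]
    (hge : IsGeometricallyErgodic P) (hP : ∀ x, P x = κ x + R x • Measure.dirac x)
    (hκ : ∀ x, κ x ≪ lam) (hR : ∀ x, R x < 1) (hlam : ∀ x, lam {x} = 0) :
    ∃ r : ℝ, r < 1 ∧ ∀ O : Set E, MeasurableSet O → (∀ y, 0 < P y O) →
      ∃ x ∈ O, R x ≤ ENNReal.ofReal r := by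
  obtain ⟨ν, hν, r, hr₀, hr₁, hint⟩ := hge
  have := isFiniteMeasure_kernel_pow P
  obtain ⟨x₀, -, hx₀⟩ := exists_mem_lt_top_of_lintegral_lt_top hint MeasurableSet.univ (by simp)
  have hconv := fun A hA => tendsto_measure_of_tvDist_bound (A := A) hr₀ hr₁ hx₀ hA
  -- Absolute continuity of `ν`: the iterates from `x₀` give a null set mass at most `R x₀ ^ n`,
  -- which tends to zero.
  have hnull : ∀ N, MeasurableSet N → lam N = 0 → ν N = 0 := by
    intro N hN h0
    refine tendsto_nhds_unique (hconv N hN) ?_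
    have h1 : ∀ n, (P ^ n) x₀ N ≤ R x₀ ^ n := fun n =>
      (pow_apply_null_le hP hκ hN h0 n x₀).trans
        (mul_le_of_le_one_right zero_le (Set.indicator_le_self' (by simp) x₀))
    exact tendsto_of_tendsto_of_tendsto_of_le_of_le tendsto_const_nhds
      (ENNReal.tendsto_pow_atTop_nhds_zero_of_lt_one (hR x₀)) (fun _ => zero_le) h1
  refine ⟨r, hr₁, fun O hO hPO => ?_⟩
  obtain ⟨x, hxO, hx⟩ :=
    exists_mem_lt_top_of_lintegral_lt_top hint hO (measure_pos_of_tendsto_pow hconv hO hPO)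
  refine ⟨x, hxO, ?_⟩
  set C := ⨆ n : ℕ, ENNReal.ofReal ((r ^ n)⁻¹) * tvDist ((P ^ n) x) ν with hC
  have hνx : ν {x} = 0 := hnull _ (measurableSet_singleton x) (hlam x)
  -- Test the total variation distance on `{x}`, which `ν` does not charge; were `R x > r`, these
  -- powers would be unbounded.
  have hle : ∀ n : ℕ, (ENNReal.ofReal r⁻¹ * R x) ^ n ≤ C := by
    intro n
    have h1 := ofReal_abs_sub_le_tvDist ((P ^ n) x) ν (measurableSet_singleton x)
    rw [measureReal_def ν, hνx, ENNReal.toReal_zero, sub_zero, abs_of_nonneg measureReal_nonneg,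
      measureReal_def, ENNReal.ofReal_toReal (measure_ne_top _ _)] at h1
    have h2 := (pow_le_pow_apply_singleton hP n x).trans h1
    rw [mul_pow, ← ENNReal.ofReal_pow (by positivity), inv_pow]
    exact (mul_le_mul_right h2 _).trans
      (le_iSup (fun n : ℕ => ENNReal.ofReal ((r ^ n)⁻¹) * tvDist ((P ^ n) x) ν) n)
  by_contra! hlt
  have h1 : 1 < ENNReal.ofReal r⁻¹ * R x := by
    rw [ENNReal.ofReal_inv_of_pos hr₀, mul_comm, ← div_eq_mul_inv,
      ENNReal.lt_div_iff_mul_lt (by simp [hr₀]) (by simp), one_mul]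
    exact hlt
  have h2 : Tendsto (fun n : ℕ => (ENNReal.ofReal r⁻¹ * R x) ^ n) atTop (𝓝 ∞) :=
    ENNReal.tendsto_pow_atTop_nhds_top_iff.mpr h1
  exact absurd ((le_of_tendsto' h2 hle).trans_lt hx) (lt_irrefl _)

end HoldingProbability

/-! ### Lebesgue measure on matrices under affine maps -/

instance instIsAddHaarMeasureMatrix {m n : Type*} [Fintype m] [Fintype n] :
    (volume : Measure (Matrix m n ℝ)).IsAddHaarMeasure :=
  Measure.pi.isAddHaarMeasure fun _ : m => (volume : Measure (n → ℝ))

theorem volume_preimage_add_smul_eq_zero_iff {p q : ℕ} {c : ℝ} (hc : c ≠ 0) (v : Mat p q)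
    (s : Set (Mat p q)) :
    volume ((fun w : Mat p q => v + c • w) ⁻¹' s) = 0 ↔ volume s = 0 := by
  have h1 : (fun w : Mat p q => v + c • w) ⁻¹' s = (c • ·) ⁻¹' ((v + ·) ⁻¹' s) := rfl
  have h2 : volume ((c • ·) ⁻¹' ((v + ·) ⁻¹' s)) =
      ENNReal.ofReal |(c ^ Module.finrank ℝ (Fin p → Fin q → ℝ))⁻¹| * volume ((v + ·) ⁻¹' s) :=
    Measure.addHaar_preimage_smul (E := Fin p → Fin q → ℝ) volume hc _
  rw [h1, h2, measure_preimage_add, mul_eq_zero]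
  simp [hc]

theorem volume_singleton_matrix {p q : ℕ} (hp : 1 ≤ p) (hq : 1 ≤ q) (x : Mat p q) :
    volume ({x} : Set (Mat p q)) = 0 := by
  have : Nonempty (Fin p) := ⟨⟨0, hp⟩⟩
  have : Nonempty (Fin q) := ⟨⟨0, hq⟩⟩
  exact measure_singleton (α := Fin p → Fin q → ℝ) (μ := volume) x

/-! ### The quadratic form of the matrix normal law -/

open scoped MatrixOrder in
theorem PDMat.sqrt_mul_self {q : ℕ} (S : PDMat q) : S.sqrt.1 * S.sqrt.1 = S.1 :=
  CFC.sqrt_mul_sqrt_self S.1 S.2.posSemidef.nonneg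

theorem PDMat.transpose_sqrt {q : ℕ} (S : PDMat q) : S.sqrt.1ᵀ = S.sqrt.1 := by
  simpa [Matrix.IsHermitian, Matrix.conjTranspose_eq_transpose_of_trivial] using
    S.sqrt.2.isHermitian

/-- The quadratic form `tr(V⁻¹ xᵀ U⁻¹ x)`. -/
noncomputable def gaussForm {p q : ℕ} (U : PDMat p) (V : PDMat q) (x : Mat p q) : ℝ :=
  (V.1⁻¹ * xᵀ * U.1⁻¹ * x).trace

theorem continuous_gaussForm {p q : ℕ} (U : PDMat p) (V : PDMat q) :
    Continuous (gaussForm U V) := by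
  unfold gaussForm
  fun_prop

theorem gaussForm_smul {p q : ℕ} (U : PDMat p) (V : PDMat q) (c : ℝ) (x : Mat p q) :
    gaussForm U V (c • x) = c ^ 2 * gaussForm U V x := by
  simp [gaussForm, Matrix.transpose_smul, Matrix.trace_smul, pow_two, mul_assoc]

open scoped Matrix.Norms.Frobenius in
-- The form is the squared Frobenius norm of `U^{-1/2} x V^{-1/2}`; undoing the two invertible
-- factors costs only the norms of their inverses.
theorem exists_sum_sq_le_gaussForm {p q : ℕ} (U : PDMat p) (V : PDMat q) :
    ∃ K : ℝ, 0 < K ∧ ∀ x : Mat p q, ∑ i, ∑ j, x i j ^ 2 ≤ K * gaussForm U V x := by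
  have hsq : ∀ {m n : ℕ} (A : Mat m n), ‖A‖ ^ 2 = ∑ i, ∑ j, A i j ^ 2 := by
    intro m n A
    rw [Matrix.frobenius_norm_def, ← Real.rpow_natCast, ← Real.rpow_mul (by positivity)]
    simp
  set C := U.inv.sqrt with hC
  set D := V.inv.sqrt with hD
  have hform : ∀ x : Mat p q, gaussForm U V x = ‖C.1 * x * D.1‖ ^ 2 := by
    intro x
    have h1 : gaussForm U V x = ((C.1 * x * D.1)ᵀ * (C.1 * x * D.1)).trace := by
      have hU : U.1⁻¹ = C.1 * C.1 := (U.inv.sqrt_mul_self).symm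
      have hV : V.1⁻¹ = D.1 * D.1 := (V.inv.sqrt_mul_self).symm
      rw [gaussForm, hU, hV, Matrix.transpose_mul, Matrix.transpose_mul, hC, hD,
        PDMat.transpose_sqrt, PDMat.transpose_sqrt, ← hC, ← hD]
      rw [show D.1 * D.1 * xᵀ * (C.1 * C.1) * x = D.1 * (D.1 * xᵀ * C.1 * C.1 * x) by
        simp only [Matrix.mul_assoc], Matrix.trace_mul_comm]
      simp only [Matrix.mul_assoc]
    rw [h1, hsq, Matrix.trace, Finset.sum_comm]
    simp only [Matrix.diag_apply, Matrix.mul_apply (M := (C.1 * x * D.1)ᵀ),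
      Matrix.transpose_apply, pow_two]
  -- The `+ 1` keeps the constant positive for empty matrices, whose norms vanish.
  refine ⟨(‖C.1⁻¹‖ * ‖D.1⁻¹‖) ^ 2 + 1, by positivity, fun x => ?_⟩
  have hx : x = C.1⁻¹ * (C.1 * x * D.1) * D.1⁻¹ := by
    have hCu : IsUnit C.1.det := (Matrix.isUnit_iff_isUnit_det _).mp C.2.isUnit
    have hDu : IsUnit D.1.det := (Matrix.isUnit_iff_isUnit_det _).mp D.2.isUnit
    rw [Matrix.mul_assoc, Matrix.mul_assoc, Matrix.mul_assoc, Matrix.mul_nonsing_inv _ hDu,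
      Matrix.mul_one, ← Matrix.mul_assoc, Matrix.nonsing_inv_mul _ hCu, Matrix.one_mul]
  have hle : ‖x‖ ≤ (‖C.1⁻¹‖ * ‖D.1⁻¹‖) * ‖C.1 * x * D.1‖ := by
    calc ‖x‖ = ‖C.1⁻¹ * (C.1 * x * D.1) * D.1⁻¹‖ := by rw [← hx]
      _ ≤ ‖C.1⁻¹ * (C.1 * x * D.1)‖ * ‖D.1⁻¹‖ := Matrix.frobenius_norm_mul _ _
      _ ≤ ‖C.1⁻¹‖ * ‖C.1 * x * D.1‖ * ‖D.1⁻¹‖ := by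
          gcongr; exact Matrix.frobenius_norm_mul _ _
      _ = _ := by ring
  rw [← hsq, hform]
  calc ‖x‖ ^ 2 ≤ ((‖C.1⁻¹‖ * ‖D.1⁻¹‖) * ‖C.1 * x * D.1‖) ^ 2 := by gcongr
    _ ≤ _ := by nlinarith [sq_nonneg ‖C.1 * x * D.1‖]

theorem gaussForm_pos {p q : ℕ} (U : PDMat p) (V : PDMat q) {x : Mat p q} (hx : x ≠ 0) :
    0 < gaussForm U V x := by
  obtain ⟨K, hK, h⟩ := exists_sum_sq_le_gaussForm U V
  refine pos_of_mul_pos_right (lt_of_lt_of_le ?_ (h x)) hK.le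
  obtain ⟨i, j, hij⟩ : ∃ i j, x i j ≠ 0 := by
    by_contra! h0
    exact hx (Matrix.ext h0)
  have h1 : x i j ^ 2 ≤ ∑ j, x i j ^ 2 :=
    Finset.single_le_sum (f := fun j => x i j ^ 2) (fun _ _ => sq_nonneg _) (Finset.mem_univ j)
  have h2 : ∑ j, x i j ^ 2 ≤ ∑ i, ∑ j, x i j ^ 2 :=
    Finset.single_le_sum (f := fun i => ∑ j, x i j ^ 2)
      (fun _ _ => Finset.sum_nonneg fun _ _ => sq_nonneg _) (Finset.mem_univ i)
  exact (by positivity : 0 < x i j ^ 2).trans_le (h1.trans h2)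

theorem matrixNormalPDF_zero {p q : ℕ} (U : PDMat p) (V : PDMat q) (x : Mat p q) :
    matrixNormalPDF 0 U V x = Real.exp (-gaussForm U V x / 2) /
      ((2 * Real.pi) ^ ((p : ℝ) * q / 2) * U.1.det ^ ((q : ℝ) / 2) * V.1.det ^ ((p : ℝ) / 2)) := by
  simp [matrixNormalPDF, gaussForm]

/-- Coercivity of the form dominates the density by a product of one-dimensional Gaussians. Total
mass one is never needed: finiteness suffices for dominated convergence and for a finite kernel. -/
instance isFiniteMeasure_matrixNormal {p q : ℕ} (U : PDMat p) (V : PDMat q) :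
    IsFiniteMeasure (matrixNormal (0 : Mat p q) U V) := by
  obtain ⟨K, hK, h⟩ := exists_sum_sq_le_gaussForm (p := p) (q := q) U V
  have h1 : Integrable (fun t : ℝ => Real.exp (-(1 / (2 * K)) * t ^ 2)) :=
    integrable_exp_neg_mul_sq (by positivity)
  have h2 : Integrable (fun x : Fin p → Fin q → ℝ =>
      ∏ i, ∏ j, Real.exp (-(1 / (2 * K)) * x i j ^ 2)) :=
    Integrable.fintype_prod (f := fun _ (y : Fin q → ℝ) =>
      ∏ j, Real.exp (-(1 / (2 * K)) * y j ^ 2))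
      fun _ => Integrable.fintype_prod (f := fun _ (t : ℝ) => Real.exp (-(1 / (2 * K)) * t ^ 2))
        fun _ => h1
  have h3 : Integrable (fun x : Mat p q => Real.exp (-gaussForm U V x / 2)) := by
    refine Integrable.mono' (g := fun x : Mat p q =>
      ∏ i, ∏ j, Real.exp (-(1 / (2 * K)) * x i j ^ 2)) h2 ?_ (Eventually.of_forall fun x => ?_)
    · exact (Real.continuous_exp.comp
        ((continuous_gaussForm U V).neg.div_const 2)).aestronglyMeasurable
    · simp only [← Real.exp_sum, ← Finset.mul_sum]
      rw [Real.norm_of_nonneg (Real.exp_pos _).le, Real.exp_le_exp]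
      have := h x
      have h4 : (1 / (2 * K)) * ∑ i, ∑ j, x i j ^ 2 ≤ (1 / (2 * K)) * (K * gaussForm U V x) := by
        gcongr
      have h5 : (1 / (2 * K)) * (K * gaussForm U V x) = gaussForm U V x / 2 := by
        field_simp
      linarith
  refine isFiniteMeasure_withDensity_ofReal ?_
  rw [funext (matrixNormalPDF_zero U V)]
  exact (h3.div_const _).hasFiniteIntegral

/-! ### The proposal -/

section Proposal

variable {p q : ℕ} (U : PDMat p) (V : PDMat q)

theorem matrixNormal_eq_zero_iff {s : Set (Mat p q)} :
    matrixNormal 0 U V s = 0 ↔ volume s = 0 := by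
  refine ⟨fun h => ?_, fun h => withDensity_absolutelyContinuous _ _ h⟩
  refine withDensity_absolutelyContinuous' (μ := volume)
    (measurable_matrixNormalPDF 0 U V).ennreal_ofReal.aemeasurable
    (Eventually.of_forall fun x => ?_) h
  exact (ENNReal.ofReal_pos.mpr (matrixNormalPDF_pos 0 U V x)).ne'

theorem measurable_pcnMove (ρ : ℝ) (x : Mat p q) :
    Measurable fun w : Mat p q => Real.sqrt ρ • x + Real.sqrt (1 - ρ) • w :=
  Continuous.measurable (by fun_prop)

/-- The proposal is the image of a law with positive density under an invertible affine map, as `ρ <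
1`. One direction gives absolute continuity of the moves, the other that every nonempty open set is
reachable from everywhere. -/
theorem pcnProposal_eq_zero_iff {ρ : ℝ} (hρ : ρ < 1) (x : Mat p q) {s : Set (Mat p q)}
    (hs : MeasurableSet s) : pcnProposal U V ρ x s = 0 ↔ volume s = 0 := by
  have hc : Real.sqrt (1 - ρ) ≠ 0 := (Real.sqrt_pos.mpr (by linarith)).ne'
  rw [pcnProposal_apply, Measure.map_apply (measurable_pcnMove ρ x) hs,
    matrixNormal_eq_zero_iff, volume_preimage_add_smul_eq_zero_iff hc]

theorem pcnProposal_apply_univ (ρ : ℝ) (x : Mat p q) :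
    pcnProposal U V ρ x Set.univ = matrixNormal 0 U V (Set.univ : Set (Mat p q)) := by
  rw [pcnProposal_apply, Measure.map_apply (measurable_pcnMove ρ x) MeasurableSet.univ,
    Set.preimage_univ]

end Proposal

/-! ### Acceptance probabilities -/

theorem acceptProb_le_one {E : Type*} (f : E → ℝ≥0∞) (x y : E) : acceptProb f x y ≤ 1 := by
  unfold acceptProb
  split_ifs
  · exact le_rfl
  · exact min_le_left _ _

theorem acceptProb_le_div {E : Type*} {f : E → ℝ≥0∞} {x : E} (hx : f x ≠ 0) (y : E) :
    acceptProb f x y ≤ f y / f x := by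
  unfold acceptProb
  rw [if_neg hx]
  exact min_le_right _ _

theorem measurable_acceptProb_right {E : Type*} [MeasurableSpace E] {f : E → ℝ≥0∞}
    (hf : Measurable f) (x : E) : Measurable (acceptProb f x) :=
  (measurable_acceptProb hf).comp measurable_prodMk_left

theorem acceptProb_pos {E : Type*} {f : E → ℝ≥0∞} {x y : E} (hx : f x ≠ ∞) (hy : f y ≠ 0) :
    0 < acceptProb f x y := by
  unfold acceptProb
  split_ifs
  · exact one_pos
  · exact lt_min one_pos (ENNReal.div_pos hy hx)

/-! ### Positivity of the target density and its consequence for acceptance rates -/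

section Target

variable {p q : ℕ} (𝒰 U : PDMat p) (V : PDMat q) {dens : PDMat q → ℝ}

/-- The Gram matrix is always positive semidefinite, so definiteness is the open condition of
nonzero determinant. -/
theorem isOpen_setOf_gram_posDef :
    IsOpen {x : Mat p q | (xᵀ * 𝒰.1⁻¹ * x).PosDef} := by
  have h : {x : Mat p q | (xᵀ * 𝒰.1⁻¹ * x).PosDef} = {x | (xᵀ * 𝒰.1⁻¹ * x).det ≠ 0} := by
    ext x
    have h0 : (xᵀ * 𝒰.1⁻¹ * x).PosSemidef := by
      simpa [Matrix.conjTranspose_eq_transpose_of_trivial] using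
        𝒰.2.inv.posSemidef.conjTranspose_mul_mul_same x
    exact h0.posDef_iff_det_ne_zero
  rw [h]
  exact isOpen_ne_fun (by fun_prop) continuous_const

theorem multivariateGamma_pos {q : ℕ} {a : ℝ} (ha : (q : ℝ) - 1 < 2 * a) :
    0 < multivariateGamma q a := by
  refine mul_pos (Real.rpow_pos_of_pos Real.pi_pos _) (Finset.prod_pos fun j _ => ?_)
  refine Real.Gamma_pos_of_pos ?_
  have : ((j : ℕ) : ℝ) + 1 ≤ q := by exact_mod_cast j.2
  linarith

theorem nuDensity_pos (hpq : q ≤ p) {x : Mat p q} (hx : (xᵀ * 𝒰.1⁻¹ * x).PosDef) :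
    0 < nuDensity 𝒰 x := by
  have h1 := hx.det_pos
  have h2 := 𝒰.2.det_pos
  have h3 : 0 < multivariateGamma q ((p : ℝ) / 2) := by
    refine multivariateGamma_pos ?_
    have : (q : ℝ) ≤ p := by exact_mod_cast hpq
    linarith
  have h4 := Real.pi_pos
  unfold nuDensity
  positivity

theorem upcastRatio_ne_top (x : Mat p q) : upcastRatio 𝒰 U V dens x ≠ ∞ := by
  have h : upcastFun 𝒰 dens x ≠ ∞ := by
    unfold upcastFun
    split_ifs <;> simp
  exact ENNReal.div_ne_top (ENNReal.mul_ne_top h ENNReal.ofReal_ne_top)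
    (ENNReal.ofReal_pos.mpr (matrixNormalPDF_pos 0 U V x)).ne'

theorem upcastRatio_eq_ofReal (hdens : ∀ S, 0 < dens S) {x : Mat p q}
    (hx : (xᵀ * 𝒰.1⁻¹ * x).PosDef) : upcastRatio 𝒰 U V dens x =
      ENNReal.ofReal (dens ⟨_, hx⟩ * nuDensity 𝒰 x / matrixNormalPDF 0 U V x) := by
  rw [upcastRatio, upcastFun, dif_pos hx, ← ENNReal.ofReal_mul (hdens _).le,
    ENNReal.ofReal_div_of_pos (matrixNormalPDF_pos 0 U V x)]

theorem upcastRatio_ne_zero (hpq : q ≤ p) (hdens : ∀ S, 0 < dens S) {x : Mat p q}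
    (hx : (xᵀ * 𝒰.1⁻¹ * x).PosDef) : upcastRatio 𝒰 U V dens x ≠ 0 := by
  rw [upcastRatio_eq_ofReal 𝒰 U V hdens hx]
  have h1 := hdens ⟨_, hx⟩
  have h2 := nuDensity_pos 𝒰 hpq hx
  have h3 := matrixNormalPDF_pos 0 U V x
  exact (ENNReal.ofReal_pos.mpr (by positivity)).ne'

/-- For a geometrically ergodic pCN kernel, the acceptance rate is bounded below at some point of
every nonempty open set of matrices of full column rank. -/
theorem exists_le_acceptance_of_isGeometricallyErgodic (hp : 1 ≤ p) (hq : 1 ≤ q) (hpq : q ≤ p)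
    {ρ : ℝ} (hρ : ρ < 1) (hd : Measurable dens) (hdens : ∀ S, 0 < dens S)
    (hne : ∃ x : Mat p q, (xᵀ * 𝒰.1⁻¹ * x).PosDef)
    (hge : IsGeometricallyErgodic (pcnKernel 𝒰 U V ρ dens hd)) :
    ∃ c : ℝ≥0∞, 0 < c ∧ ∀ O : Set (Mat p q), IsOpen O → O.Nonempty →
      (∀ x ∈ O, (xᵀ * 𝒰.1⁻¹ * x).PosDef) →
      ∃ x ∈ O, c ≤ ∫⁻ y, acceptProb (upcastRatio 𝒰 U V dens) x y ∂(pcnProposal U V ρ x) := by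
  set f := upcastRatio 𝒰 U V dens with hf
  set Q := pcnProposal U V ρ with hQ
  have hfm : Measurable f := measurable_upcastRatio 𝒰 U V hd
  have hP : ∀ x, pcnKernel 𝒰 U V ρ dens hd x = (Q x).withDensity (acceptProb f x) +
      (1 - ∫⁻ y, acceptProb f x y ∂(Q x)) • Measure.dirac x := fun x => rfl
  have hacc : ∀ O : Set (Mat p q), IsOpen O → O.Nonempty →
      (∀ x ∈ O, (xᵀ * 𝒰.1⁻¹ * x).PosDef) → ∀ x, 0 < ∫⁻ y in O, acceptProb f x y ∂(Q x) := by
    intro O hO hOne hOfull x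
    have hpos : 0 < Q x O := by
      rw [pos_iff_ne_zero, Ne, hQ, pcnProposal_eq_zero_iff U V hρ x hO.measurableSet]
      exact (hO.measure_pos volume hOne).ne'
    rw [setLIntegral_pos_iff (measurable_acceptProb_right hfm x)]
    refine hpos.trans_le (measure_mono fun y hy => ⟨?_, hy⟩)
    exact (acceptProb_pos (upcastRatio_ne_top 𝒰 U V x)
      (upcastRatio_ne_zero 𝒰 U V hpq hdens (hOfull y hy))).ne'
  have hfin : IsFiniteKernel (pcnKernel 𝒰 U V ρ dens hd) := by
    refine ⟨⟨matrixNormal 0 U V (Set.univ : Set (Mat p q)) + 1, by simp, fun x => ?_⟩⟩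
    rw [hP x, Measure.add_apply, withDensity_apply _ MeasurableSet.univ, Measure.smul_apply,
      Measure.dirac_apply_of_mem (Set.mem_univ x), smul_eq_mul, mul_one]
    refine add_le_add ?_ tsub_le_self
    rw [← pcnProposal_apply_univ U V ρ x, Measure.restrict_univ]
    calc ∫⁻ y, acceptProb f x y ∂(Q x) ≤ ∫⁻ _, 1 ∂(Q x) :=
          lintegral_mono fun y => acceptProb_le_one f x y
      _ = _ := by simp [hQ]
  have hκ : ∀ x, (Q x).withDensity (acceptProb f x) ≪ volume := fun x =>
    (withDensity_absolutelyContinuous _ _).trans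
      (Measure.AbsolutelyContinuous.mk fun s hs h0 =>
        (pcnProposal_eq_zero_iff U V hρ x hs).mpr h0)
  have hR : ∀ x, 1 - ∫⁻ y, acceptProb f x y ∂(Q x) < 1 := by
    intro x
    refine ENNReal.sub_lt_self (by simp) (by simp) ?_
    have h1 := hacc _ (isOpen_setOf_gram_posDef 𝒰) hne (fun _ h => h) x
    exact (h1.trans_le (setLIntegral_le_lintegral _ _)).ne'
  obtain ⟨r, hr, H⟩ :=
    hge.exists_holding_le hP hκ hR (fun x => volume_singleton_matrix hp hq x)
  refine ⟨1 - ENNReal.ofReal r, ?_, fun O hO hOne hOfull => ?_⟩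
  · rw [tsub_pos_iff_lt]
    exact ENNReal.ofReal_lt_one.mpr hr
  · obtain ⟨x, hx, hle⟩ := H O hO.measurableSet fun y => by
      rw [hP y, Measure.add_apply, withDensity_apply _ hO.measurableSet]
      exact (hacc O hO hOne hOfull y).trans_le le_self_add
    exact ⟨x, hx, by rw [tsub_le_iff_left]; exact tsub_le_iff_right.mp hle⟩

end Target

/-- Extension by zero of a function on `P⁺(q)` to all `q × q` matrices. -/
noncomputable def zeroExtend {q : ℕ} (dens : PDMat q → ℝ) (S : Mat q q) : ℝ :=
  open Classical in if h : S.PosDef then dens ⟨S, h⟩ else 0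

theorem zeroExtend_of_posDef {q : ℕ} (dens : PDMat q → ℝ) {S : Mat q q} (hS : S.PosDef) :
    zeroExtend dens S = dens ⟨S, hS⟩ :=
  dif_pos hS

/-- The ratios `h(z S) / h(z I)` have a positive limit as `z → ∞` and `S → B`, for every
`B ∈ P⁺(q)`. -/
def HasScalingLimit {q : ℕ} (dens : PDMat q → ℝ) : Prop :=
  ∃ φ : Mat q q → ℝ, ∀ B : Mat q q, B.PosDef → 0 < φ B ∧
    Tendsto (fun zS : ℝ × Mat q q => zeroExtend dens (zS.1 • zS.2) / zeroExtend dens (zS.1 • 1))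
      (atTop ×ˢ 𝓝[{S | S.PosDef}] B) (𝓝 (φ B))

/-! ### Acceptance rates along rays -/

section Gram

variable {p q : ℕ} (𝒰 : PDMat p)

/-- The Gram matrix `xᵀ 𝒰⁻¹ x`. -/
noncomputable def gram (x : Mat p q) : Mat q q := xᵀ * 𝒰.1⁻¹ * x

theorem continuous_gram : Continuous (gram 𝒰 : Mat p q → Mat q q) := by
  unfold gram
  fun_prop

theorem gram_smul (c : ℝ) (x : Mat p q) : gram 𝒰 (c • x) = c ^ 2 • gram 𝒰 x := by
  simp [gram, Matrix.transpose_smul, smul_smul, pow_two]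

theorem gram_smul_posDef {c : ℝ} (hc : c ≠ 0) {x : Mat p q} (hx : (gram 𝒰 x).PosDef) :
    (gram 𝒰 (c • x)).PosDef := by
  rw [gram_smul]
  exact hx.smul (by positivity)

theorem eventually_gram_posDef {x₀ : Mat p q} (hx₀ : (gram 𝒰 x₀).PosDef) :
    ∀ᶠ x in 𝓝 x₀, (gram 𝒰 x).PosDef :=
  (isOpen_setOf_gram_posDef 𝒰).mem_nhds hx₀

theorem tendsto_gram {x₀ : Mat p q} (hx₀ : (gram 𝒰 x₀).PosDef) :
    Tendsto (gram 𝒰) (𝓝 x₀) (𝓝[{S | S.PosDef}] gram 𝒰 x₀) :=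
  tendsto_nhdsWithin_iff.mpr ⟨(continuous_gram 𝒰).tendsto x₀, eventually_gram_posDef 𝒰 hx₀⟩

/-- The inclusion of the first `q` coordinates is injective, which is where `q ≤ p` enters. -/
theorem exists_gram_posDef (hpq : q ≤ p) : ∃ x : Mat p q, (gram 𝒰 x).PosDef := by
  let J : Mat p q := Matrix.of fun i j => if i = Fin.castLE hpq j then 1 else 0
  have hJ : ∀ (v : Fin q → ℝ) (j : Fin q), (J *ᵥ v) (Fin.castLE hpq j) = v j := by
    intro v j
    simp [J, Matrix.mulVec, dotProduct]
  refine ⟨J, ?_⟩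
  have h := 𝒰.2.inv.conjTranspose_mul_mul_same (B := J) fun v w hvw => by
    ext j
    rw [← hJ v j, ← hJ w j, hvw]
  simpa [gram, Matrix.conjTranspose_eq_transpose_of_trivial] using h

theorem ne_zero_of_gram_posDef (hq : 1 ≤ q) {x : Mat p q} (hx : (gram 𝒰 x).PosDef) : x ≠ 0 := by
  rintro rfl
  have : Nonempty (Fin q) := ⟨⟨0, hq⟩⟩
  have h := hx.det_pos
  simp [gram] at h

end Gram

/-! ### Factorization of the target density along rays and vanishing acceptance -/

section Ratio

variable {p q : ℕ} (𝒰 U : PDMat p) (V : PDMat q) (dens : PDMat q → ℝ)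

/-- The density `upcastRatio` up to a multiplicative constant. -/
noncomputable def upcastShape (x : Mat p q) : ℝ :=
  zeroExtend dens (gram 𝒰 x) * (gram 𝒰 x).det ^ (-(p : ℝ) / 2) * Real.exp (gaussForm U V x / 2)

theorem upcastShape_pos (hdens : ∀ S, 0 < dens S) {x : Mat p q} (hx : (gram 𝒰 x).PosDef) :
    0 < upcastShape 𝒰 U V dens x := by
  have h1 := hdens ⟨_, hx⟩
  have h2 := hx.det_pos
  rw [upcastShape, zeroExtend_of_posDef _ hx]
  positivity

theorem exists_upcastRatio_eq (hpq : q ≤ p) (hdens : ∀ S, 0 < dens S) :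
    ∃ K : ℝ, 0 < K ∧ ∀ x : Mat p q, (gram 𝒰 x).PosDef →
      upcastRatio 𝒰 U V dens x = ENNReal.ofReal (K * upcastShape 𝒰 U V dens x) := by
  have h1 := U.2.det_pos
  have h2 := V.2.det_pos
  have h3 := 𝒰.2.det_pos
  have h4 := Real.pi_pos
  have h5 : 0 < multivariateGamma q ((p : ℝ) / 2) := by
    refine multivariateGamma_pos ?_
    have : (q : ℝ) ≤ p := by exact_mod_cast hpq
    linarith
  refine ⟨multivariateGamma q ((p : ℝ) / 2) / Real.pi ^ ((p : ℝ) * q / 2) *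
    𝒰.1.det ^ (-(q : ℝ) / 2) * ((2 * Real.pi) ^ ((p : ℝ) * q / 2) * U.1.det ^ ((q : ℝ) / 2) *
      V.1.det ^ ((p : ℝ) / 2)), by positivity, fun x hx => ?_⟩
  rw [upcastRatio_eq_ofReal 𝒰 U V hdens hx]
  congr 1
  have h6 := hx.det_pos
  rw [upcastShape, zeroExtend_of_posDef _ hx, matrixNormalPDF_zero, nuDensity, neg_div (2 : ℝ) (p : ℝ),
    Real.rpow_neg h6.le, neg_div (2 : ℝ) (gaussForm U V x), Real.exp_neg]
  change _ * (_ * (_ / (gram 𝒰 x).det ^ ((p : ℝ) / 2))) / _ = _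
  change dens ⟨gram 𝒰 x, hx⟩ * _ / _ = _
  field_simp

/-- The factor of `upcastShape` along a ray that does not depend on the direction. -/
noncomputable def rayFactor (p : ℕ) (s : ℝ) : ℝ :=
  zeroExtend dens (s • 1) * (s ^ q) ^ (-(p : ℝ) / 2)

/-- The factor of `upcastShape` along a ray that converges at infinity. -/
noncomputable def dirFactor (s : ℝ) (x : Mat p q) : ℝ :=
  zeroExtend dens (s • gram 𝒰 x) / zeroExtend dens (s • 1) * (gram 𝒰 x).det ^ (-(p : ℝ) / 2)

theorem zeroExtend_smul_one_pos (hdens : ∀ S, 0 < dens S) {s : ℝ} (hs : 0 < s) :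
    0 < zeroExtend dens (s • 1) := by
  rw [zeroExtend_of_posDef _ (Matrix.PosDef.one.smul hs)]
  exact hdens _

theorem rayFactor_pos (hdens : ∀ S, 0 < dens S) {s : ℝ} (hs : 0 < s) :
    0 < rayFactor dens p s := by
  have := zeroExtend_smul_one_pos dens hdens hs
  unfold rayFactor
  positivity

theorem upcastShape_sqrt_smul (hdens : ∀ S, 0 < dens S) {s : ℝ} (hs : 0 < s) {x : Mat p q}
    (hx : (gram 𝒰 x).PosDef) : upcastShape 𝒰 U V dens (Real.sqrt s • x) =
      rayFactor dens p s * dirFactor 𝒰 dens s x * Real.exp (s * (gaussForm U V x / 2)) := by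
  have h1 := zeroExtend_smul_one_pos dens hdens hs
  rw [upcastShape, rayFactor, dirFactor, gram_smul, gaussForm_smul, Real.sq_sqrt hs.le,
    Matrix.det_smul, Fintype.card_fin, Real.mul_rpow (by positivity) hx.det_pos.le, mul_div_assoc]
  field_simp

variable {dens}

theorem exists_tendsto_dirFactor (hlim : HasScalingLimit dens) {x₀ : Mat p q}
    (hx₀ : (gram 𝒰 x₀).PosDef) : ∃ a : ℝ, 0 < a ∧
      Tendsto (fun sx : ℝ × Mat p q => dirFactor 𝒰 dens sx.1 sx.2) (atTop ×ˢ 𝓝 x₀) (𝓝 a) := by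
  obtain ⟨φ, hφ⟩ := hlim
  obtain ⟨hpos, hB⟩ := hφ _ hx₀
  have hdet := hx₀.det_pos
  refine ⟨φ (gram 𝒰 x₀) * (gram 𝒰 x₀).det ^ (-(p : ℝ) / 2), by positivity, ?_⟩
  have h1 : Tendsto (fun sx : ℝ × Mat p q => (sx.1, gram 𝒰 sx.2)) (atTop ×ˢ 𝓝 x₀)
      (atTop ×ˢ 𝓝[{S | S.PosDef}] gram 𝒰 x₀) :=
    tendsto_fst.prodMk ((tendsto_gram 𝒰 hx₀).comp tendsto_snd)
  have h2 : Tendsto (fun sx : ℝ × Mat p q => (gram 𝒰 sx.2).det) (atTop ×ˢ 𝓝 x₀)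
      (𝓝 (gram 𝒰 x₀).det) :=
    ((continuous_gram 𝒰).matrix_det.tendsto x₀).comp tendsto_snd
  unfold dirFactor
  exact (hB.comp h1).mul (h2.rpow_const (Or.inl hdet.ne'))

/-- Ratio test along dyadic scales: doubling the scale multiplies `rayFactor` by a quantity with a
positive limit, whereas the exponential gains `exp (2 ^ k * δ)`. No explicit decay rate of
`rayFactor` is required. -/
theorem tendsto_rayFactor_mul_exp (hdens : ∀ S, 0 < dens S) (hlim : HasScalingLimit dens)
    (p : ℕ) {δ : ℝ} (hδ : 0 < δ) :
    Tendsto (fun k : ℕ => rayFactor dens p (2 ^ k) * Real.exp (2 ^ k * δ)) atTop atTop := by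
  obtain ⟨φ, hφ⟩ := hlim
  have h2 : ((2 : ℝ) • (1 : Mat q q)).PosDef := Matrix.PosDef.one.smul two_pos
  obtain ⟨hpos, hB⟩ := hφ _ h2
  set u : ℕ → ℝ := fun k => rayFactor dens p (2 ^ k) * Real.exp (2 ^ k * δ) with hu
  have hupos : ∀ k, 0 < u k := fun k =>
    mul_pos (rayFactor_pos dens hdens (by positivity)) (Real.exp_pos _)
  have hpow : Tendsto (fun k : ℕ => (2 : ℝ) ^ k) atTop atTop :=
    tendsto_pow_atTop_atTop_of_one_lt one_lt_two
  have hrat : Tendsto (fun k => u (k + 1) / u k) atTop atTop := by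
    have h3 : ∀ k, u (k + 1) / u k = (zeroExtend dens ((2 : ℝ) ^ k • (2 : ℝ) • (1 : Mat q q)) /
        zeroExtend dens ((2 : ℝ) ^ k • (1 : Mat q q)) * ((2 : ℝ) ^ q) ^ (-(p : ℝ) / 2)) *
          Real.exp (2 ^ k * δ) := by
      intro k
      have h4 := zeroExtend_smul_one_pos dens hdens (s := 2 ^ k) (by positivity)
      have h5 : Real.exp (2 ^ (k + 1) * δ) = Real.exp (2 ^ k * δ) * Real.exp (2 ^ k * δ) := by
        rw [← Real.exp_add]; ring_nf
      have h6 : (((2 : ℝ) ^ (k + 1)) ^ q) ^ (-(p : ℝ) / 2) =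
          (((2 : ℝ) ^ k) ^ q) ^ (-(p : ℝ) / 2) * ((2 : ℝ) ^ q) ^ (-(p : ℝ) / 2) := by
        rw [← Real.mul_rpow (by positivity) (by positivity), pow_succ, mul_pow]
      simp only [hu, rayFactor]
      rw [h5, h6, smul_smul, ← pow_succ]
      field_simp
    simp only [h3]
    have h7 : Tendsto (fun k : ℕ => ((2 : ℝ) ^ k, (2 : ℝ) • (1 : Mat q q))) atTop
        (atTop ×ˢ 𝓝[{S | S.PosDef}] ((2 : ℝ) • (1 : Mat q q))) :=
      hpow.prodMk
        (tendsto_nhdsWithin_iff.mpr ⟨tendsto_const_nhds, Eventually.of_forall fun _ => h2⟩)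
    have h8 := (hB.comp h7).mul_const (((2 : ℝ) ^ q) ^ (-(p : ℝ) / 2))
    exact h8.pos_mul_atTop (by positivity)
      (Real.tendsto_exp_atTop.comp (hpow.atTop_mul_const hδ))
  obtain ⟨N, hN⟩ := eventually_atTop.mp (hrat.eventually_ge_atTop 2)
  refine (tendsto_add_atTop_iff_nat N).mp
    (tendsto_atTop_of_geom_le (c := 2) (hupos _) one_lt_two fun n => ?_)
  have := hN (n + N) (by omega)
  rw [le_div_iff₀ (hupos _)] at this
  rwa [show n + 1 + N = n + N + 1 by ring]

theorem tendsto_two_pow_prod (x₀ : Mat p q) :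
    Tendsto (fun kx : ℕ × Mat p q => ((2 : ℝ) ^ kx.1, kx.2)) (atTop ×ˢ 𝓝 x₀) (atTop ×ˢ 𝓝 x₀) :=
  (tendsto_pow_atTop_atTop_of_one_lt one_lt_two).prodMap tendsto_id

theorem tendsto_upcastShape_atTop (hq : 1 ≤ q) (hdens : ∀ S, 0 < dens S)
    (hlim : HasScalingLimit dens) {x₀ : Mat p q} (hx₀ : (gram 𝒰 x₀).PosDef) :
    Tendsto (fun kx : ℕ × Mat p q => upcastShape 𝒰 U V dens (Real.sqrt (2 ^ kx.1) • kx.2))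
      (atTop ×ˢ 𝓝 x₀) atTop := by
  obtain ⟨a, ha, hA⟩ := exists_tendsto_dirFactor 𝒰 hlim hx₀
  have hN : 0 < gaussForm U V x₀ := gaussForm_pos U V (ne_zero_of_gram_posDef 𝒰 hq hx₀)
  -- The exponent `gaussForm U V x₀ / 2` is split in halves: one beats any decay of `rayFactor`, the
  -- other leaves room for directions varying near `x₀`.
  have h1 := (tendsto_rayFactor_mul_exp hdens hlim p
    (δ := gaussForm U V x₀ / 4) (by positivity)).comp (tendsto_fst (g := 𝓝 x₀))
  have h2 : Tendsto (fun kx : ℕ × Mat p q =>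
      (2 : ℝ) ^ kx.1 * (gaussForm U V kx.2 / 2 - gaussForm U V x₀ / 4)) (atTop ×ˢ 𝓝 x₀) atTop := by
    refine Tendsto.atTop_mul_pos (C := gaussForm U V x₀ / 2 - gaussForm U V x₀ / 4) (by linarith)
      ((tendsto_pow_atTop_atTop_of_one_lt one_lt_two).comp tendsto_fst) ?_
    exact (((continuous_gaussForm U V).tendsto x₀).comp tendsto_snd).div_const 2 |>.sub_const _
  have h3 := (h1.atTop_mul_atTop₀ (Real.tendsto_exp_atTop.comp h2)).atTop_mul_pos ha
    (hA.comp (tendsto_two_pow_prod x₀))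
  refine h3.congr' ?_
  filter_upwards [tendsto_snd.eventually (eventually_gram_posDef 𝒰 hx₀)] with kx hkx
  rw [upcastShape_sqrt_smul 𝒰 U V dens hdens (by positivity) hkx]
  simp only [Function.comp_apply]
  rw [show (2 : ℝ) ^ kx.1 * (gaussForm U V kx.2 / 2) = 2 ^ kx.1 * (gaussForm U V x₀ / 4) +
    2 ^ kx.1 * (gaussForm U V kx.2 / 2 - gaussForm U V x₀ / 4) by ring, Real.exp_add]
  ring

/-- Both points have the same scale, so `rayFactor` cancels and the direction factors converge. What
remains is the exponential of `s` times a difference tending to `(ρ - 1) * gaussForm U V x₀ / 2 <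
0`. -/
theorem tendsto_upcastShape_ratio (hq : 1 ≤ q) (hdens : ∀ S, 0 < dens S)
    (hlim : HasScalingLimit dens) {ρ : ℝ} (hρ₀ : 0 < ρ) (hρ₁ : ρ < 1) {x₀ : Mat p q}
    (hx₀ : (gram 𝒰 x₀).PosDef) {y : ℝ × Mat p q → Mat p q}
    (hy : Tendsto y (atTop ×ˢ 𝓝 x₀) (𝓝 (Real.sqrt ρ • x₀))) :
    Tendsto (fun sx : ℝ × Mat p q => upcastShape 𝒰 U V dens (Real.sqrt sx.1 • y sx) /
      upcastShape 𝒰 U V dens (Real.sqrt sx.1 • sx.2)) (atTop ×ˢ 𝓝 x₀) (𝓝 0) := by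
  have hy₀ : (gram 𝒰 (Real.sqrt ρ • x₀)).PosDef :=
    gram_smul_posDef 𝒰 (Real.sqrt_pos.mpr hρ₀).ne' hx₀
  obtain ⟨a, ha, hA⟩ := exists_tendsto_dirFactor 𝒰 hlim hx₀
  obtain ⟨b, hb, hB⟩ := exists_tendsto_dirFactor 𝒰 hlim hy₀
  have hN : 0 < gaussForm U V x₀ := gaussForm_pos U V (ne_zero_of_gram_posDef 𝒰 hq hx₀)
  have h1 : Tendsto (fun sx : ℝ × Mat p q => sx.1 * (gaussForm U V (y sx) / 2 -
      gaussForm U V sx.2 / 2)) (atTop ×ˢ 𝓝 x₀) atBot := by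
    refine Tendsto.atTop_mul_neg (C := gaussForm U V (Real.sqrt ρ • x₀) / 2 - gaussForm U V x₀ / 2)
      ?_ tendsto_fst ?_
    · rw [gaussForm_smul, Real.sq_sqrt hρ₀.le]
      nlinarith
    · exact ((((continuous_gaussForm U V).tendsto _).comp hy).div_const 2).sub
        ((((continuous_gaussForm U V).tendsto x₀).comp tendsto_snd).div_const 2)
  have h2 := ((hB.comp (tendsto_fst.prodMk hy)).div hA ha.ne').mul (Real.tendsto_exp_atBot.comp h1)
  rw [mul_zero] at h2
  refine h2.congr' ?_
  filter_upwards [tendsto_snd.eventually (eventually_gram_posDef 𝒰 hx₀),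
    hy.eventually (eventually_gram_posDef 𝒰 hy₀),
    tendsto_fst.eventually (eventually_gt_atTop (0 : ℝ))] with sx h3 h4 h5
  have h6 := rayFactor_pos (p := p) dens hdens h5
  simp only [Function.comp_apply, Pi.div_apply]
  rw [upcastShape_sqrt_smul 𝒰 U V dens hdens h5 h3, upcastShape_sqrt_smul 𝒰 U V dens hdens h5 h4,
    mul_sub, Real.exp_sub, mul_assoc, mul_assoc (rayFactor dens p sx.1), mul_div_mul_left _ _ h6.ne',
    mul_div_mul_comm]

theorem tendsto_acceptProb (hq : 1 ≤ q) (hpq : q ≤ p) (hdens : ∀ S, 0 < dens S)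
    (hlim : HasScalingLimit dens) {ρ : ℝ} (hρ₀ : 0 ≤ ρ) (hρ₁ : ρ < 1) {x₀ : Mat p q}
    (hx₀ : (gram 𝒰 x₀).PosDef) (w : Mat p q) :
    Tendsto (fun kx : ℕ × Mat p q => acceptProb (upcastRatio 𝒰 U V dens)
      (Real.sqrt (2 ^ kx.1) • kx.2)
      (Real.sqrt ρ • Real.sqrt (2 ^ kx.1) • kx.2 + Real.sqrt (1 - ρ) • w))
      (atTop ×ˢ 𝓝 x₀) (𝓝 0) := by
  obtain ⟨K, hK, hf⟩ := exists_upcastRatio_eq 𝒰 U V dens hpq hdens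
  have hfull : ∀ᶠ kx : ℕ × Mat p q in atTop ×ˢ 𝓝 x₀,
      (gram 𝒰 (Real.sqrt (2 ^ kx.1) • kx.2)).PosDef := by
    filter_upwards [tendsto_snd.eventually (eventually_gram_posDef 𝒰 hx₀)] with kx hkx
    exact gram_smul_posDef 𝒰 (by positivity) hkx
  suffices h : Tendsto (fun kx : ℕ × Mat p q =>
      upcastRatio 𝒰 U V dens
        (Real.sqrt ρ • Real.sqrt (2 ^ kx.1) • kx.2 + Real.sqrt (1 - ρ) • w) /
        upcastRatio 𝒰 U V dens (Real.sqrt (2 ^ kx.1) • kx.2)) (atTop ×ˢ 𝓝 x₀) (𝓝 0) by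
    refine tendsto_of_tendsto_of_tendsto_of_le_of_le' tendsto_const_nhds h
      (Eventually.of_forall fun _ => zero_le) ?_
    filter_upwards [hfull] with kx hkx
    exact acceptProb_le_div (upcastRatio_ne_zero 𝒰 U V hpq hdens hkx) _
  -- For `ρ = 0` the limiting direction would be the zero matrix, where no scaling limit is
  -- available. But then the proposal does not depend on the current state, and it suffices that the
  -- density at that state diverges.
  rcases hρ₀.eq_or_lt with rfl | hρ₀
  · simp only [Real.sqrt_zero, zero_smul, zero_add]
    have h1 : Tendsto (fun kx : ℕ × Mat p q =>
        upcastRatio 𝒰 U V dens (Real.sqrt (2 ^ kx.1) • kx.2)) (atTop ×ˢ 𝓝 x₀) (𝓝 ∞) := by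
      refine (ENNReal.tendsto_ofReal_atTop.comp
        ((tendsto_upcastShape_atTop 𝒰 U V hq hdens hlim hx₀).const_mul_atTop hK)).congr' ?_
      filter_upwards [hfull] with kx hkx
      exact (hf _ hkx).symm
    have h2 := ENNReal.Tendsto.const_div
      (a := upcastRatio 𝒰 U V dens (Real.sqrt (1 - 0) • w)) h1
      (Or.inr (upcastRatio_ne_top 𝒰 U V _))
    rwa [ENNReal.div_top] at h2
  -- Factor `√s` out of the move: the noise then carries `1 / √s`, and the direction tends to `√ρ •
  -- x₀`.
  · set y : ℝ × Mat p q → Mat p q := fun sx =>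
      Real.sqrt ρ • sx.2 + ((Real.sqrt sx.1)⁻¹ * Real.sqrt (1 - ρ)) • w with hy
    have hylim : Tendsto y (atTop ×ˢ 𝓝 x₀) (𝓝 (Real.sqrt ρ • x₀)) := by
      have h1 : Tendsto (fun sx : ℝ × Mat p q => (Real.sqrt sx.1)⁻¹ * Real.sqrt (1 - ρ))
          (atTop ×ˢ 𝓝 x₀) (𝓝 0) := by
        simpa using ((tendsto_inv_atTop_zero.comp Real.tendsto_sqrt_atTop).comp
          (tendsto_fst (g := 𝓝 x₀))).mul_const (Real.sqrt (1 - ρ))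
      have h2 := ((tendsto_snd (f := (atTop : Filter ℝ)) (g := 𝓝 x₀)).const_smul
        (Real.sqrt ρ)).add (h1.smul_const w)
      simpa using h2
    have hymove : ∀ kx : ℕ × Mat p q, Real.sqrt ρ • Real.sqrt (2 ^ kx.1) • kx.2 +
        Real.sqrt (1 - ρ) • w = Real.sqrt (2 ^ kx.1) • y (2 ^ kx.1, kx.2) := by
      intro kx
      have : Real.sqrt (2 ^ kx.1) ≠ 0 := by positivity
      simp only [hy, smul_add, smul_smul]
      rw [mul_comm, mul_inv_cancel_left₀ this]
    have hyfull : ∀ᶠ kx : ℕ × Mat p q in atTop ×ˢ 𝓝 x₀,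
        (gram 𝒰 (Real.sqrt (2 ^ kx.1) • y (2 ^ kx.1, kx.2))).PosDef := by
      have h1 := (tendsto_two_pow_prod x₀).eventually (hylim.eventually
        (eventually_gram_posDef 𝒰 (gram_smul_posDef 𝒰 (Real.sqrt_pos.mpr hρ₀).ne' hx₀)))
      filter_upwards [h1] with kx hkx
      exact gram_smul_posDef 𝒰 (by positivity) hkx
    have h1 := ENNReal.tendsto_ofReal ((tendsto_upcastShape_ratio 𝒰 U V hq hdens hlim hρ₀ hρ₁ hx₀
      hylim).comp (tendsto_two_pow_prod x₀))
    rw [ENNReal.ofReal_zero] at h1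
    refine h1.congr' ?_
    filter_upwards [hfull, hyfull] with kx h2 h3
    have h4 := upcastShape_pos 𝒰 U V dens hdens h2
    rw [hymove, hf _ h2, hf _ h3, ← ENNReal.ofReal_div_of_pos (by positivity),
      mul_div_mul_left _ _ hK.ne']
    rfl

/-- Dominated convergence with bound `1`. The limit is joint in scale and direction because
ergodicity yields a good point only somewhere in an open set, so smallness is needed on a whole
neighbourhood. -/
theorem tendsto_acceptance (hq : 1 ≤ q) (hpq : q ≤ p) (hd : Measurable dens)
    (hdens : ∀ S, 0 < dens S)
    (hlim : HasScalingLimit dens) {ρ : ℝ} (hρ₀ : 0 ≤ ρ) (hρ₁ : ρ < 1) {x₀ : Mat p q}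
    (hx₀ : (gram 𝒰 x₀).PosDef) :
    Tendsto (fun kx : ℕ × Mat p q => ∫⁻ y, acceptProb (upcastRatio 𝒰 U V dens)
      (Real.sqrt (2 ^ kx.1) • kx.2) y ∂(pcnProposal U V ρ (Real.sqrt (2 ^ kx.1) • kx.2)))
      (atTop ×ˢ 𝓝 x₀) (𝓝 0) := by
  have hm := fun x => measurable_acceptProb_right (measurable_upcastRatio 𝒰 U V hd) x
  simp only [pcnProposal_apply, lintegral_map (hm _) (measurable_pcnMove _ _)]
  have h := tendsto_lintegral_filter_of_dominated_convergence (μ := matrixNormal 0 U V)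
    (F := fun (kx : ℕ × Mat p q) w => acceptProb (upcastRatio 𝒰 U V dens)
      (Real.sqrt (2 ^ kx.1) • kx.2)
      (Real.sqrt ρ • Real.sqrt (2 ^ kx.1) • kx.2 + Real.sqrt (1 - ρ) • w)) (f := fun _ => 0)
    (l := atTop ×ˢ 𝓝 x₀) (fun _ => 1)
    (Eventually.of_forall fun kx => (hm _).comp (measurable_pcnMove ρ _))
    (Eventually.of_forall fun kx => Eventually.of_forall fun w => acceptProb_le_one _ _ _)
    (by simp)
    (Eventually.of_forall fun w => tendsto_acceptProb 𝒰 U V hq hpq hdens hlim hρ₀ hρ₁ hx₀ w)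
  simpa using h

/-- The acceptance rate of the pCN kernel vanishes along rays of matrices of full column rank, so
the kernel is not geometrically ergodic. -/
theorem not_isGeometricallyErgodic_pcnKernel (hq : 1 ≤ q) (hpq : q ≤ p) (hd : Measurable dens)
    (hdens : ∀ S, 0 < dens S) (hlim : HasScalingLimit dens) {ρ : ℝ} (hρ₀ : 0 ≤ ρ) (hρ₁ : ρ < 1) :
    ¬ IsGeometricallyErgodic (pcnKernel 𝒰 U V ρ dens hd) := by
  intro hge
  obtain ⟨x₀, hx₀⟩ := exists_gram_posDef 𝒰 hpq
  obtain ⟨c, hc, H⟩ := exists_le_acceptance_of_isGeometricallyErgodic 𝒰 U V (hq.trans hpq) hq hpq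
    hρ₁ hd hdens ⟨x₀, hx₀⟩ hge
  have hev := (tendsto_acceptance 𝒰 U V hq hpq hd hdens hlim hρ₀ hρ₁ hx₀).eventually
    (eventually_lt_nhds hc)
  -- The product filter gives one scale `k` that works for all directions in a neighbourhood of
  -- `x₀`; the dilate of that neighbourhood by `√(2 ^ k)` is the sticky open set.
  obtain ⟨pa, hpa, pb, hpb, hab⟩ := eventually_prod_iff.mp hev
  obtain ⟨k, hk⟩ := hpa.exists
  obtain ⟨W, hW, hWo, hxW⟩ := eventually_nhds_iff.mp (hpb.and (eventually_gram_posDef 𝒰 hx₀))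
  have hs : Real.sqrt (2 ^ k) ≠ 0 := by positivity
  have hx : ∀ x : Mat p q, Real.sqrt (2 ^ k) • (Real.sqrt (2 ^ k))⁻¹ • x = x := fun x =>
    smul_inv_smul₀ hs x
  obtain ⟨x, hxO, hle⟩ := H ((fun x => (Real.sqrt (2 ^ k))⁻¹ • x) ⁻¹' W)
    (hWo.preimage (continuous_const_smul _))
    ⟨Real.sqrt (2 ^ k) • x₀, by simpa [Set.mem_preimage, inv_smul_smul₀ hs] using hxW⟩
    fun x hxO => by
      have h1 := gram_smul_posDef 𝒰 hs (hW _ hxO).2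
      rwa [hx] at h1
  have h2 := hab hk (hW _ hxO).1
  simp only [hx] at h2
  exact absurd h2 (not_lt.mpr hle)

end Ratio

/-! ### Regularly varying densities -/

/-- Gershgorin's theorem: the eigenvalue lies in a disc around a diagonal entry, with radius the
off-diagonal row sum. -/
theorem abs_eigenvalues_sub_one_le {q : ℕ} {A : Mat q q} (hA : A.IsHermitian) (i : Fin q) :
    |hA.eigenvalues i - 1| ≤ ∑ k, ∑ j, |(A - 1) k j| := by
  have h1 : Module.End.HasEigenvalue (Matrix.toLin' A) (hA.eigenvalues i) := by
    rw [Module.End.hasEigenvalue_iff_mem_spectrum, Matrix.spectrum_toLin']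
    exact hA.eigenvalues_mem_spectrum_real i
  obtain ⟨k, hk⟩ := eigenvalue_mem_ball h1
  rw [Metric.mem_closedBall, Real.dist_eq] at hk
  have h2 : ∑ j ∈ Finset.univ.erase k, ‖A k j‖ = ∑ j ∈ Finset.univ.erase k, |(A - 1) k j| := by
    refine Finset.sum_congr rfl fun j hj => ?_
    rw [Matrix.sub_apply, Matrix.one_apply_ne (Finset.ne_of_mem_erase hj).symm, sub_zero,
      Real.norm_eq_abs]
  have h3 : |(A - 1) k k| + ∑ j ∈ Finset.univ.erase k, |(A - 1) k j| = ∑ j, |(A - 1) k j| :=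
    Finset.add_sum_erase _ (fun j => |(A - 1) k j|) (Finset.mem_univ k)
  have h4 : ∑ j, |(A - 1) k j| ≤ ∑ k, ∑ j, |(A - 1) k j| :=
    Finset.single_le_sum (f := fun k => ∑ j, |(A - 1) k j|)
      (fun _ _ => Finset.sum_nonneg fun _ _ => abs_nonneg _) (Finset.mem_univ k)
  have h5 : |hA.eigenvalues i - 1| ≤ |hA.eigenvalues i - A k k| + |A k k - 1| :=
    abs_sub_le _ _ _
  have h6 : (A - 1) k k = A k k - 1 := by simp
  rw [h2] at hk
  rw [h6] at h3
  linarith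

theorem PDMat.sqrt_inv_mul_mul_sqrt_inv {q : ℕ} (B : PDMat q) :
    B.inv.sqrt.1 * B.1 * B.inv.sqrt.1 = 1 := by
  have hB : IsUnit B.1.det := (Matrix.isUnit_iff_isUnit_det _).mp B.2.isUnit
  have h1 : B.inv.sqrt.1 * (B.inv.sqrt.1 * B.1) = 1 := by
    rw [← Matrix.mul_assoc, PDMat.sqrt_mul_self]
    exact Matrix.nonsing_inv_mul _ hB
  exact mul_eq_one_comm.mp h1

/-- As `S → B`, the matrix `B^{-1/2} S B^{-1/2}` tends to the identity, so its eigenvalues tend to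
`1` and their logarithms to `0`. -/
theorem eventually_logDist_lt {q : ℕ} (B : PDMat q) {ε : ℝ} (hε : 0 < ε) :
    ∀ᶠ S in 𝓝 B.1, ∀ hS : S.PosDef, PDMat.logDist ⟨S, hS⟩ B < ε := by
  -- Dividing by `q + 1` makes the sum of `q` terms strictly less than `ε ^ 2`, also for `q = 0`.
  have hlog : ∀ᶠ t : ℝ in 𝓝 1, Real.log t ^ 2 < ε ^ 2 / (q + 1) := by
    have h1 : Tendsto (fun t : ℝ => Real.log t ^ 2) (𝓝 1) (𝓝 0) := by
      simpa using (Real.continuousAt_log one_ne_zero).tendsto.pow 2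
    exact h1.eventually (eventually_lt_nhds (by positivity))
  obtain ⟨η, hη, hlog⟩ := Metric.eventually_nhds_iff.mp hlog
  set e : Mat q q → ℝ := fun S =>
    ∑ k, ∑ j, |(B.inv.sqrt.1 * S * B.inv.sqrt.1 - 1) k j| with he
  have hcont : Continuous e := by
    refine continuous_finsetSum _ fun k _ => continuous_finsetSum _ fun j _ => ?_
    have : Continuous fun S : Mat q q => B.inv.sqrt.1 * S * B.inv.sqrt.1 - 1 := by fun_prop
    exact (this.matrix_elem k j).abs
  have he0 : e B.1 = 0 := by
    simp [he, PDMat.sqrt_inv_mul_mul_sqrt_inv]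
  have hev : ∀ᶠ S in 𝓝 B.1, e S < η :=
    hcont.continuousAt.eventually (eventually_lt_nhds (by rwa [he0]))
  filter_upwards [hev] with S heS hS
  rw [PDMat.logDist, Real.sqrt_lt' hε]
  refine (Finset.sum_le_sum fun i _ => (hlog ?_).le).trans_lt (b := ∑ _ : Fin q, ε ^ 2 / (q + 1)) ?_
  · rw [Real.dist_eq]
    exact (abs_eigenvalues_sub_one_le _ i).trans_lt heS
  · rw [Finset.sum_const, Finset.card_univ, Fintype.card_fin, nsmul_eq_mul, ← mul_div_assoc,
      div_lt_iff₀ (by positivity)]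
    nlinarith [pow_pos hε 2]

theorem IsRegularlyVarying.hasScalingLimit {q : ℕ} {dens : PDMat q → ℝ}
    (h : IsRegularlyVarying dens) : HasScalingLimit dens := by
  obtain ⟨-, r, -, H⟩ := h
  refine ⟨fun B => B.det ^ (-r / 2), fun B hB => ⟨Real.rpow_pos_of_pos hB.det_pos _, ?_⟩⟩
  obtain ⟨ε, hε, H⟩ := H ⟨B, hB⟩
  rw [Metric.tendsto_nhds]
  intro δ hδ
  have hdet : ∀ᶠ S in 𝓝 B, |S.det ^ (-r / 2) - B.det ^ (-r / 2)| < δ / 2 := by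
    have h1 : Tendsto (fun S : Mat q q => S.det ^ (-r / 2)) (𝓝 B) (𝓝 (B.det ^ (-r / 2))) :=
      ((continuous_id.matrix_det).tendsto B).rpow_const (Or.inl hB.det_pos.ne')
    exact Metric.tendsto_nhds.mp h1 _ (half_pos hδ)
  obtain ⟨z₀, H⟩ := H (δ / 2) (half_pos hδ)
  filter_upwards [tendsto_fst.eventually (eventually_ge_atTop z₀),
    tendsto_fst.eventually (eventually_gt_atTop (0 : ℝ)),
    tendsto_snd.eventually self_mem_nhdsWithin,
    tendsto_snd.eventually (nhdsWithin_le_nhds (eventually_logDist_lt ⟨B, hB⟩ hε)),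
    tendsto_snd.eventually (nhdsWithin_le_nhds hdet)] with zS h1 h2 h3 h4 h5
  have h6 := H zS.1 h2 h1 ⟨zS.2, h3⟩ (h4 h3)
  have h7 : zeroExtend dens (zS.1 • zS.2) = dens (PDMat.scale zS.1 h2 ⟨zS.2, h3⟩) :=
    zeroExtend_of_posDef dens (PDMat.scale zS.1 h2 ⟨zS.2, h3⟩).2
  have h8 : zeroExtend dens (zS.1 • 1) = dens ((PDMat.one q).scale zS.1 h2) :=
    zeroExtend_of_posDef dens ((PDMat.one q).scale zS.1 h2).2
  rw [h7, h8, Real.dist_eq]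
  exact (abs_sub_le _ (zS.2.det ^ (-r / 2)) _).trans_lt (by linarith)

/-! ### Inverse-Wishart densities -/

theorem invWishartDensity_pos {q : ℕ} {r : ℝ} (hr : (q : ℝ) - 1 < r) (T S : PDMat q) :
    0 < invWishartDensity r T S := by
  have h1 := T.2.det_pos
  have h2 := S.2.det_pos
  have h3 : 0 < multivariateGamma q (r / 2) := multivariateGamma_pos (by linarith)
  unfold invWishartDensity
  positivity

/-- Scaling by `z` multiplies both determinants by `z ^ q`, which cancels, and divides the trace
terms by `z`, so the exponential factor tends to `1`. -/
theorem hasScalingLimit_invWishartDensity {q : ℕ} {r : ℝ} (hr : (q : ℝ) - 1 < r) (T : PDMat q) :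
    HasScalingLimit (invWishartDensity r T) := by
  refine ⟨fun B => B.det ^ (-r / 2), fun B hB => ⟨Real.rpow_pos_of_pos hB.det_pos _, ?_⟩⟩
  have hdet : Tendsto (fun S : Mat q q => S.det) (𝓝[{S | S.PosDef}] B) (𝓝 B.det) :=
    (continuous_id.matrix_det.tendsto B).mono_left nhdsWithin_le_nhds
  have htr : Tendsto (fun S : Mat q q => (T.1 * S⁻¹).trace) (𝓝[{S | S.PosDef}] B)
      (𝓝 (T.1 * B⁻¹).trace) := by
    have h1 : ∀ S : Mat q q, (T.1 * S⁻¹).trace = S.det⁻¹ * (T.1 * S.adjugate).trace := by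
      intro S
      simp [Matrix.inv_def, Matrix.trace_smul]
    have h2 : Continuous fun S : Mat q q => (T.1 * S.adjugate).trace := by fun_prop
    simp only [h1]
    exact (hdet.inv₀ hB.det_pos.ne').mul ((h2.tendsto B).mono_left nhdsWithin_le_nhds)
  have hexp : Tendsto (fun zS : ℝ × Mat q q =>
      Real.exp (zS.1⁻¹ * ((T.1.trace - (T.1 * zS.2⁻¹).trace) / 2)) * zS.2.det ^ (-r / 2))
      (atTop ×ˢ 𝓝[{S | S.PosDef}] B) (𝓝 (B.det ^ (-r / 2))) := by
    have h1 := (tendsto_inv_atTop_zero.comp tendsto_fst).mul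
      (((htr.comp (tendsto_snd (f := (atTop : Filter ℝ)))).const_sub T.1.trace).div_const 2)
    have h2 := ((Real.continuous_exp.tendsto _).comp h1).mul
      ((hdet.comp (tendsto_snd (f := (atTop : Filter ℝ)))).rpow_const
        (p := -r / 2) (Or.inl hB.det_pos.ne'))
    simpa using h2
  refine hexp.congr' ?_
  filter_upwards [tendsto_fst.eventually (eventually_gt_atTop (0 : ℝ)),
    tendsto_snd.eventually self_mem_nhdsWithin] with zS hz hS
  have hΓ : 0 < multivariateGamma q (r / 2) := multivariateGamma_pos (by linarith)
  have hT := T.2.det_pos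
  have hS' : 0 < zS.2.det := Matrix.PosDef.det_pos hS
  have h3 : ∀ S : Mat q q, S.PosDef → zeroExtend (invWishartDensity r T) (zS.1 • S) =
      T.1.det ^ (r / 2) * Real.exp (-(zS.1⁻¹ * (T.1 * S⁻¹).trace) / 2) /
        ((2 : ℝ) ^ (r * q / 2) * ((zS.1 ^ q) ^ (r / 2) * S.det ^ (r / 2)) *
          multivariateGamma q (r / 2)) := by
    intro S hS
    have hunit : IsUnit S.det := (Matrix.isUnit_iff_isUnit_det _).mp hS.isUnit
    rw [zeroExtend_of_posDef _ (hS.smul hz), invWishartDensity]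
    have h4 : (zS.1 • S)⁻¹ = zS.1⁻¹ • S⁻¹ := Matrix.inv_smul' S (Units.mk0 zS.1 hz.ne') hunit
    simp only [h4, Matrix.det_smul, Fintype.card_fin, Matrix.mul_smul, Matrix.trace_smul,
      smul_eq_mul]
    rw [Real.mul_rpow (by positivity) hS.det_pos.le]
  rw [h3 _ hS, h3 _ Matrix.PosDef.one, neg_div 2 r, Real.rpow_neg hS'.le,
    show zS.1⁻¹ * ((T.1.trace - (T.1 * zS.2⁻¹).trace) / 2) =
      -(zS.1⁻¹ * (T.1 * zS.2⁻¹).trace) / 2 - -(zS.1⁻¹ * T.1.trace) / 2 by ring, Real.exp_sub]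
  simp only [inv_one, Matrix.mul_one, Matrix.det_one, Real.one_rpow]
  field_simp

end MatrixMCMC

theorem mainTheorem7 (p q : ℕ) (hq : 1 ≤ q) (hpq : q ≤ p)
    (𝒰 U : PDMat p) (V : PDMat q) (ρ : ℝ) (hρ₀ : 0 ≤ ρ) (hρ₁ : ρ < 1) :
    (∀ (dens : PDMat q → ℝ) (hcont : Continuous dens),
      IsProbabilityMeasure ((muPD q).withDensity fun S => ENNReal.ofReal (dens S)) →
      IsRegularlyVarying dens →
      ¬ IsGeometricallyErgodic (pcnKernel 𝒰 U V ρ dens hcont.measurable)) ∧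
    (∀ (r : ℝ), (q : ℝ) - 1 < r → ∀ T : PDMat q,
      ¬ IsGeometricallyErgodic
        (pcnKernel 𝒰 U V ρ (invWishartDensity r T) (measurable_invWishartDensity r T))) :=
  ⟨fun _ hcont _ hreg => not_isGeometricallyErgodic_pcnKernel 𝒰 U V hq hpq hcont.measurable
      hreg.1 hreg.hasScalingLimit hρ₀ hρ₁,
    fun r hr T => not_isGeometricallyErgodic_pcnKernel 𝒰 U V hq hpq
      (measurable_invWishartDensity r T) (invWishartDensity_pos hr T)
      (hasScalingLimit_invWishartDensity hr T) hρ₀ hρ₁⟩
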